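/- Let $SG_{2,4}(n)$ be the generalized two-dimensional Sierpinski gasket with $b=4$ layers: $SG_{2,4}(0)$ is a triangle (three vertices, three edges), and $SG_{2,4}(n+1)$ is obtained by placing ten copies of $SG_{2,4}(n)$ as the upward triangles of a large triangle with four layers, copies that touch sharing an outmost (corner) vertex. Let $v_n$ be the number of vertices of $SG_{2,4}(n)$. Let $f(n)$ be the number of connected spanning subgraphs of $SG_{2,4}(n)$; let $g(n)$ be the number of its spanning subgraphs with exactly two connected components, one containing the topmost vertex and the other containing the other two outmost vertices; let $h(n)$ be the number of its spanning subgraphs with exactly three connected components, each containing one of the three outmost vertices. Put $\alpha(n)=f(n)/g(n)$, $\beta(n)=g(n)/h(n)$, and, with $a=\alpha(m)$, $c=\beta(m)$, \[ \begin{aligned} P(m)={}&11354+5856\tfrac{a}{c}+516\tfrac{a^2}{c^2}+2\tfrac{a^3}{c^3}+13626a+4140\tfrac{a^2}{c}+174\tfrac{a^3}{c^2}+6936a^2+1140\tfrac{a^3}{c}+15\tfrac{a^4}{c^2}\\ &+1928a^3+144\tfrac{a^4}{c}+309a^4+7\tfrac{a^5}{c}+27a^5+a^6,\\ Q(m)={}&13732+14480\tfrac{a}{c}+2786\tfrac{a^2}{c^2}+82\tfrac{a^3}{c^3}+16250a+10609\tfrac{a^2}{c}+1095\tfrac{a^3}{c^2}+12\tfrac{a^4}{c^3}+8015a^2+3130\tfrac{a^3}{c}\\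 &+142\tfrac{a^4}{c^2}+2148a^3+462\tfrac{a^4}{c}+6\tfrac{a^5}{c^2}+332a^4+34\tfrac{a^5}{c}+28a^5+\tfrac{a^6}{c}+a^6 . \end{aligned} \] Then the limit (asymptotic growth constant) \[ z_{SG_{2,4}}=\lim_{n\to\infty}\frac{\ln f(n)}{v_n} \] exists; for every integer $m\ge 1$ it satisfies \[ \frac{\ln f(m)+2\ln g(m)}{4\cdot 10^m}+\frac{\ln 33620+2\ln 84460}{36\cdot 10^m}\;\le\; z_{SG_{2,4}}\;\le\;\frac{\ln f(m)+2\ln g(m)}{4\cdot 10^m}+\frac{\ln P(m)+2\ln Q(m)}{36\cdot 10^m}; \] and its decimal expansion begins $z_{SG_{2,4}}=1.4849112\ldots$, that is, $1.4849112\le z_{SG_{2,4}}<1.4849113$. -/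

import Mathlib

open Filter Topology

/-! ### The gasket graph

Points of the triangular lattice are written in the basis of two unit vectors at an angle of
60 degrees, so a point is a pair of natural numbers. -/

/-- Positions of the upward unit triangles in a triangle built from `b` layers, `b` being the
side length. -/
def layerCells (b : ℕ) : Finset (ℕ × ℕ) :=
  (Finset.range b ×ˢ Finset.range b).filter fun d => d.1 + d.2 < b

/-- Lower left corners of the unit triangles of the stage `n` gasket. Stage `0` is one triangle;
stage `n + 1` consists of copies of stage `n` (which has side length `b ^ n`), arranged in
`b` layers. -/
def gasketCells (b : ℕ) : ℕ → Finset (ℕ × ℕ)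
  | 0 => {(0, 0)}
  | n + 1 => (layerCells b).biUnion fun d =>
      (gasketCells b n).image fun c => (b ^ n * d.1 + c.1, b ^ n * d.2 + c.2)

/-- The three corners of the upward unit triangle with lower left corner `c`. -/
def triangleCorners (c : ℕ × ℕ) : Finset (ℕ × ℕ) :=
  {c, (c.1 + 1, c.2), (c.1, c.2 + 1)}

/-- The vertices of the stage `n` gasket. -/
def gasketVerts (b n : ℕ) : Finset (ℕ × ℕ) :=
  (gasketCells b n).biUnion triangleCorners

/-- The generalized two-dimensional Sierpinski gasket `SG_{2,b}(n)`: two distinct vertices are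
adjacent when they are corners of a common unit triangle of the gasket. -/
def gasket (b n : ℕ) : SimpleGraph (gasketVerts b n) where
  Adj p q := p ≠ q ∧ ∃ c ∈ gasketCells b n, p.1 ∈ triangleCorners c ∧ q.1 ∈ triangleCorners c
  symm := ⟨by
    rintro p q ⟨h, c, hc, hp, hq⟩
    exact ⟨h.symm, c, hc, hq, hp⟩⟩
  loopless := ⟨fun _ h => h.1 rfl⟩

/-! ### The three outmost vertices -/

theorem mem_layerCells {b i j : ℕ} (h : i + j < b) : (i, j) ∈ layerCells b := by
  simp only [layerCells, Finset.mem_filter, Finset.mem_product, Finset.mem_range]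
  omega

theorem left_cell_mem (b : ℕ) [NeZero b] (n : ℕ) : ((0, 0) : ℕ × ℕ) ∈ gasketCells b n := by
  induction n with
  | zero => simp [gasketCells]
  | succ n ih =>
    have hb := Nat.pos_of_ne_zero (NeZero.ne b)
    exact Finset.mem_biUnion.2 ⟨(0, 0), mem_layerCells (by omega),
      Finset.mem_image.2 ⟨(0, 0), ih, by simp⟩⟩

theorem right_cell_mem (b : ℕ) [NeZero b] (n : ℕ) : (b ^ n - 1, 0) ∈ gasketCells b n := by
  induction n with
  | zero => simp [gasketCells]
  | succ n ih =>
    have hb := Nat.pos_of_ne_zero (NeZero.ne b)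
    have hn : 0 < b ^ n := Nat.pow_pos hb
    obtain ⟨k, rfl⟩ : ∃ k, b = k + 1 := ⟨b - 1, by omega⟩
    refine Finset.mem_biUnion.2 ⟨(k, 0), mem_layerCells (by omega),
      Finset.mem_image.2 ⟨_, ih, ?_⟩⟩
    simp only [Prod.mk.injEq, mul_zero, add_zero, and_true, pow_succ, mul_add, mul_one]
    omega

theorem top_cell_mem (b : ℕ) [NeZero b] (n : ℕ) : (0, b ^ n - 1) ∈ gasketCells b n := by
  induction n with
  | zero => simp [gasketCells]
  | succ n ih =>
    have hb := Nat.pos_of_ne_zero (NeZero.ne b)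
    have hn : 0 < b ^ n := Nat.pow_pos hb
    obtain ⟨k, rfl⟩ : ∃ k, b = k + 1 := ⟨b - 1, by omega⟩
    refine Finset.mem_biUnion.2 ⟨(0, k), mem_layerCells (by omega),
      Finset.mem_image.2 ⟨_, ih, ?_⟩⟩
    simp only [Prod.mk.injEq, mul_zero, add_zero, true_and, pow_succ, mul_add, mul_one]
    omega

/-- The lower left outmost vertex. -/
def leftVertex (b : ℕ) [NeZero b] (n : ℕ) : gasketVerts b n :=
  ⟨(0, 0), Finset.mem_biUnion.2 ⟨_, left_cell_mem b n, by simp [triangleCorners]⟩⟩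

/-- The lower right outmost vertex. -/
def rightVertex (b : ℕ) [NeZero b] (n : ℕ) : gasketVerts b n :=
  ⟨(b ^ n, 0), Finset.mem_biUnion.2 ⟨_, right_cell_mem b n, by
    have hn : 0 < b ^ n := Nat.pow_pos (Nat.pos_of_ne_zero (NeZero.ne b))
    simp [triangleCorners, Nat.sub_add_cancel hn]⟩⟩

/-- The topmost outmost vertex. -/
def topVertex (b : ℕ) [NeZero b] (n : ℕ) : gasketVerts b n :=
  ⟨(0, b ^ n), Finset.mem_biUnion.2 ⟨_, top_cell_mem b n, by
    have hn : 0 < b ^ n := Nat.pow_pos (Nat.pos_of_ne_zero (NeZero.ne b))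
    simp [triangleCorners, Nat.sub_add_cancel hn]⟩⟩

/-! ### Counting spanning subgraphs

A spanning subgraph of `G : SimpleGraph V` is a simple graph `H ≤ G` on the same vertices. -/

/-- The number of connected spanning subgraphs of `G`. -/
noncomputable def numCSSG {V : Type*} (G : SimpleGraph V) : ℕ :=
  {H : SimpleGraph V | H ≤ G ∧ H.Connected}.ncard

/-- `f_{2,b}(n)`: the number of connected spanning subgraphs of the gasket. -/
noncomputable def gasketF (b n : ℕ) : ℕ := numCSSG (gasket b n)

/-- `g_{2,b}(n)`: the number of spanning subgraphs with two connected components, one containing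
the topmost vertex and the other one containing the other two outmost vertices. -/
noncomputable def gasketG (b : ℕ) [NeZero b] (n : ℕ) : ℕ :=
  {H : SimpleGraph (gasketVerts b n) | H ≤ gasket b n ∧ Nat.card H.ConnectedComponent = 2 ∧
    H.Reachable (leftVertex b n) (rightVertex b n) ∧
    ¬ H.Reachable (topVertex b n) (leftVertex b n)}.ncard

/-- `h_{2,b}(n)`: the number of spanning subgraphs with three connected components, each
containing one outmost vertex. -/
noncomputable def gasketH (b : ℕ) [NeZero b] (n : ℕ) : ℕ :=
  {H : SimpleGraph (gasketVerts b n) | H ≤ gasket b n ∧ Nat.card H.ConnectedComponent = 3 ∧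
    ¬ H.Reachable (leftVertex b n) (rightVertex b n) ∧
    ¬ H.Reachable (topVertex b n) (leftVertex b n) ∧
    ¬ H.Reachable (topVertex b n) (rightVertex b n)}.ncard

/-- `α_{2,b}(n) = f_{2,b}(n) / g_{2,b}(n)`. -/
noncomputable def gasketAlpha (b : ℕ) [NeZero b] (n : ℕ) : ℝ := (gasketF b n : ℝ) / gasketG b n

/-- `β_{2,b}(n) = g_{2,b}(n) / h_{2,b}(n)`. -/
noncomputable def gasketBeta (b : ℕ) [NeZero b] (n : ℕ) : ℝ := (gasketG b n : ℝ) / gasketH b n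

/-- The function of `a = α_{2,4}(m)` and `c = β_{2,4}(m)` denoted `P_{2,4}(m)`. -/
noncomputable def polyP (a c : ℝ) : ℝ :=
  11354 + 5856 * (a / c) + 516 * (a ^ 2 / c ^ 2) + 2 * (a ^ 3 / c ^ 3) + 13626 * a
    + 4140 * (a ^ 2 / c) + 174 * (a ^ 3 / c ^ 2) + 6936 * a ^ 2 + 1140 * (a ^ 3 / c)
    + 15 * (a ^ 4 / c ^ 2) + 1928 * a ^ 3 + 144 * (a ^ 4 / c) + 309 * a ^ 4
    + 7 * (a ^ 5 / c) + 27 * a ^ 5 + a ^ 6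

/-- The function of `a = α_{2,4}(m)` and `c = β_{2,4}(m)` denoted `Q_{2,4}(m)`. -/
noncomputable def polyQ (a c : ℝ) : ℝ :=
  13732 + 14480 * (a / c) + 2786 * (a ^ 2 / c ^ 2) + 82 * (a ^ 3 / c ^ 3) + 16250 * a
    + 10609 * (a ^ 2 / c) + 1095 * (a ^ 3 / c ^ 2) + 12 * (a ^ 4 / c ^ 3) + 8015 * a ^ 2
    + 3130 * (a ^ 3 / c) + 142 * (a ^ 4 / c ^ 2) + 2148 * a ^ 3 + 462 * (a ^ 4 / c)
    + 6 * (a ^ 5 / c ^ 2) + 332 * a ^ 4 + 34 * (a ^ 5 / c) + 28 * a ^ 5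
    + a ^ 6 / c + a ^ 6

/-! Call a spanning subgraph admissible when each of its components contains an outmost vertex. It
induces one of five partitions of the three outmost vertices. An admissible subgraph of stage `n +
1` restricts on each of the ten copies to an admissible subgraph, because a component of the
restriction that misses the corners of its copy could never leave the copy. Conversely, the
partition pattern of the union depends only on the ten patterns
(`IsGluing.hasPattern_gluedGraph_iff`). So the pattern counts of stage `n + 1` are homogeneous
polynomials of degree ten in those of stage `n`.

Their coefficients count the assignments of patterns to the ten copies, 5 ^ 10 in all. They are
found by a dynamic programme over partitions of the fifteen nodes, evaluated at one large Kronecker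
point by the kernel (`readOff_advanceAll`). No coefficient reaches 2 ^ 24, so the value has the
coefficients as its base 2 ^ 24 digits (`sum_patterns_eq`).

In the variables a = f/g and r = fh/g² = α/β the recurrence reads f' = f⁴g⁶P, g' = f³g⁷Q, h' =
f²g⁸R, with P, Q, R increasing polynomials in a and r. The row vector (1, 2) is a left eigenvector
with eigenvalue 10 of the exponent matrix with rows (4, 6), (3, 7), so ln f + 2 ln g is multiplied
by 10 and increased by ln P + 2 ln Q (`logSum_succ`). Divided by 10ⁿ it converges to some T. As ln f
= ((ln f + 2 ln g) + 2 ln α)/3, |ln α| grows at most linearly and v_n = (4·10ⁿ + 5)/3, the growth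
constant is T/4.

For the two bounds, a and r both decrease and r ≥ 3 (`InRegion.next`). Hence each increment after
stage m is at most the one at stage m, and at least its value at a = 0, r = 3, where P = 33620 and Q
= 84460; summing a geometric series gives both estimates. The decimals come from m = 5 with interval
arithmetic on a, r and logarithms. -/

/-! ### Partition patterns of three terminals -/

/-- The five partition patterns of three points: all joined, one pair joined, none joined. -/
def joins (t : Fin 5) (i j : Fin 3) : Prop :=
  i = j ∨ t = 0 ∨ (t = 1 ∧ i ≠ 2 ∧ j ≠ 2) ∨ (t = 2 ∧ i ≠ 1 ∧ j ≠ 1) ∨ (t = 3 ∧ i ≠ 0 ∧ j ≠ 0)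

instance (t : Fin 5) (i j : Fin 3) : Decidable (joins t i j) := by
  unfold joins; infer_instance

/-- Every point is related to one of the three terminals, and the terminals are related to each
other according to the pattern `t`. -/
def HasPattern {V : Type*} (r : V → V → Prop) (τ : Fin 3 → V) (t : Fin 5) : Prop :=
  (∀ v, ∃ i, r v (τ i)) ∧ ∀ i j, r (τ i) (τ j) ↔ joins t i j

/-- The number of spanning subgraphs in which every component contains a terminal and the
terminals are connected according to the pattern `t`. -/
noncomputable def patternCount {V : Type*} (S : SimpleGraph V) (τ : Fin 3 → V) (t : Fin 5) : ℕ :=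
  {K : SimpleGraph V | K ≤ S ∧ HasPattern K.Reachable τ t}.ncard

theorem joins_injective {t u : Fin 5} (h : ∀ i j, joins t i j ↔ joins u i j) : t = u := by
  revert t u; decide

/-- Of the eight truth assignments to the three pairs, transitivity excludes the three in which
exactly two pairs are related. -/
theorem exists_joins {V : Type*} {r : V → V → Prop} (hr : Equivalence r) (τ : Fin 3 → V) :
    ∃ t, ∀ i j, r (τ i) (τ j) ↔ joins t i j := by
  have key : ∀ a b c : Prop, (a → b → c) → (a → c → b) → (b → c → a) →
      ∃ t, (a ↔ joins t 0 1) ∧ (b ↔ joins t 0 2) ∧ (c ↔ joins t 1 2) := by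
    intro a b c h1 h2 h3
    by_cases ha : a <;> by_cases hb : b <;> by_cases hc : c
    · exact ⟨0, by simp [ha, hb, hc, joins]⟩
    · exact absurd (h1 ha hb) hc
    · exact absurd (h2 ha hc) hb
    · exact ⟨1, by simp [ha, hb, hc, joins]⟩
    · exact absurd (h3 hb hc) ha
    · exact ⟨2, by simp [ha, hb, hc, joins]⟩
    · exact ⟨3, by simp [ha, hb, hc, joins]⟩
    · exact ⟨4, by simp [ha, hb, hc, joins]⟩
  obtain ⟨t, h01, h02, h12⟩ := key (r (τ 0) (τ 1)) (r (τ 0) (τ 2)) (r (τ 1) (τ 2))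
    (fun h h' => hr.trans (hr.symm h) h') (fun h h' => hr.trans h h')
    (fun h h' => hr.trans h (hr.symm h'))
  have js : ∀ (t : Fin 5) i j, joins t i j ↔ joins t j i := by decide
  have jr : ∀ (t : Fin 5) i, joins t i i := by decide
  have hs : ∀ x y, r x y ↔ r y x := fun x y => ⟨hr.symm, hr.symm⟩
  refine ⟨t, fun i j => ?_⟩
  fin_cases i <;> fin_cases j <;>
    first
    | exact iff_of_true (hr.refl _) (jr _ _)
    | assumption
    | (rw [hs, js t]; assumption)

theorem HasPattern.unique {V : Type*} {r : V → V → Prop} {τ : Fin 3 → V} {t u : Fin 5}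
    (ht : HasPattern r τ t) (hu : HasPattern r τ u) : t = u :=
  joins_injective fun i j => (ht.2 i j).symm.trans (hu.2 i j)

/-! ### Gluing copies along terminals -/

/-- `G` is made from copies `φ d` of `S` which share at most their terminals `τ`; the vertex
`ν (κ d i)` is the terminal `i` of the copy `d`. -/
structure IsGluing {V W D X : Type*} (S : SimpleGraph V) (τ : Fin 3 → V) (G : SimpleGraph W)
    (φ : D → V → W) (κ : D → Fin 3 → X) (ν : X → W) : Prop where
  inj : ∀ d, Function.Injective (φ d)
  adj : ∀ p q, G.Adj p q ↔ ∃ d u v, S.Adj u v ∧ φ d u = p ∧ φ d v = q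
  meet : ∀ {d e u v}, d ≠ e → φ d u = φ e v → ∃ i, u = τ i
  meet_unique : ∀ {d e u u' v v'}, d ≠ e → φ d u = φ e u' → φ d v = φ e v' → u = v
  cover : ∀ w, ∃ d u, φ d u = w
  corner : ∀ d i, φ d (τ i) = ν (κ d i)
  node_inj : Function.Injective ν
  node_cover : ∀ x, ∃ d i, κ d i = x

/-- The union of spanning subgraphs of the copies. -/
def gluedGraph {V W D : Type*} (φ : D → V → W) (k : D → SimpleGraph V) : SimpleGraph W where
  Adj p q := p ≠ q ∧ ∃ d u v, (k d).Adj u v ∧ φ d u = p ∧ φ d v = q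
  symm := ⟨by
    rintro p q ⟨h, d, u, v, huv, hu, hv⟩
    exact ⟨h.symm, d, v, u, huv.symm, hv, hu⟩⟩
  loopless := ⟨fun _ h => h.1 rfl⟩

/-- The relation between terminals of copies that the patterns `s d` of the copies generate. -/
def nodeRel {D X : Type*} (κ : D → Fin 3 → X) (s : D → Fin 5) : X → X → Prop :=
  Relation.EqvGen fun x y => ∃ d i j, κ d i = x ∧ κ d j = y ∧ joins (s d) i j

theorem nodeRel_equivalence {D X : Type*} (κ : D → Fin 3 → X) (s : D → Fin 5) :
    Equivalence (nodeRel κ s) :=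
  Relation.EqvGen.is_equivalence _

namespace IsGluing

variable {V W D X : Type*} {S : SimpleGraph V} {τ : Fin 3 → V} {G : SimpleGraph W}
  {φ : D → V → W} {κ : D → Fin 3 → X} {ν : X → W}

theorem gluedGraph_adj (h : IsGluing S τ G φ κ ν) {k : D → SimpleGraph V} {p q : W} :
    (gluedGraph φ k).Adj p q ↔ ∃ d u v, (k d).Adj u v ∧ φ d u = p ∧ φ d v = q := by
  refine ⟨fun a => a.2, fun a => ⟨?_, a⟩⟩
  obtain ⟨d, u, v, huv, rfl, rfl⟩ := a
  exact fun e => huv.ne (h.inj d e)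

theorem gluedGraph_le (h : IsGluing S τ G φ κ ν) {k : D → SimpleGraph V} (hk : ∀ d, k d ≤ S) :
    gluedGraph φ k ≤ G := by
  intro p q hpq
  obtain ⟨d, u, v, huv, hu, hv⟩ := h.gluedGraph_adj.1 hpq
  exact (h.adj p q).2 ⟨d, u, v, hk d huv, hu, hv⟩

/-- Distinct copies share at most one vertex (`meet_unique`), so an edge of the union lies in only
one copy, and each part can be recovered from the union. -/
theorem gluedGraph_injective (h : IsGluing S τ G φ κ ν) :
    Function.Injective (gluedGraph φ : (D → SimpleGraph V) → SimpleGraph W) := by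
  have key : ∀ (k : D → SimpleGraph V) d u v,
      (k d).Adj u v ↔ (gluedGraph φ k).Adj (φ d u) (φ d v) := by
    intro k d u v
    rw [h.gluedGraph_adj]
    refine ⟨fun a => ⟨d, u, v, a, rfl, rfl⟩, ?_⟩
    rintro ⟨e, u', v', a, hu, hv⟩
    by_cases hde : e = d
    · subst hde
      rwa [← h.inj e hu, ← h.inj e hv]
    · exact absurd (h.meet_unique hde hu hv) a.ne
  intro k k' hkk
  ext d u v
  rw [key, key, hkk]

theorem exists_gluedGraph_eq (h : IsGluing S τ G φ κ ν) {H : SimpleGraph W} (hH : H ≤ G) :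
    ∃ k : D → SimpleGraph V, (∀ d, k d ≤ S) ∧ gluedGraph φ k = H := by
  refine ⟨fun d => H.comap (φ d) ⊓ S, fun d => inf_le_right, ?_⟩
  ext p q
  rw [h.gluedGraph_adj]
  constructor
  · rintro ⟨d, u, v, a, rfl, rfl⟩
    exact a.1
  · intro a
    obtain ⟨d, u, v, huv, rfl, rfl⟩ := (h.adj p q).1 (hH a)
    exact ⟨d, u, v, ⟨a, huv⟩, rfl, rfl⟩

theorem reachable_copy (h : IsGluing S τ G φ κ ν) {k : D → SimpleGraph V} {d : D} {u v : V}
    (huv : (k d).Reachable u v) : (gluedGraph φ k).Reachable (φ d u) (φ d v) := by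
  let f : k d →g gluedGraph φ k :=
    ⟨φ d, fun {a b} hab => h.gluedGraph_adj.2 ⟨d, a, b, hab, rfl, rfl⟩⟩
  exact huv.map f

/-- A component of `k d` without terminals is closed under adjacency in the union, since other
copies are entered only through terminals. A walk from it therefore never reaches a node. -/
theorem covers_copy (h : IsGluing S τ G φ κ ν) {k : D → SimpleGraph V} {σ : Fin 3 → X}
    (hc : ∀ w, ∃ i, (gluedGraph φ k).Reachable w (ν (σ i))) (d : D) (v : V) :
    ∃ i, (k d).Reachable v (τ i) := by
  by_contra! hv
  have step : ∀ p q, (gluedGraph φ k).Adj p q → (∃ u, p = φ d u ∧ (k d).Reachable v u) →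
      ∃ u, q = φ d u ∧ (k d).Reachable v u := by
    rintro p q hpq ⟨u, rfl, hu⟩
    obtain ⟨e, a, b, hab, ha, rfl⟩ := h.gluedGraph_adj.1 hpq
    by_cases hde : d = e
    · subst hde
      rw [h.inj d ha] at hab
      exact ⟨b, rfl, hu.trans hab.reachable⟩
    · obtain ⟨i, rfl⟩ := h.meet hde ha.symm
      exact absurd hu (hv i)
  obtain ⟨i, hi⟩ := hc (φ d v)
  obtain ⟨u, hu, hvu⟩ : ∃ u, ν (σ i) = φ d u ∧ (k d).Reachable v u := by
    obtain ⟨p⟩ := hi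
    have : ∀ {a b : W} (p : (gluedGraph φ k).Walk a b),
        (∃ u, a = φ d u ∧ (k d).Reachable v u) → ∃ u, b = φ d u ∧ (k d).Reachable v u := by
      intro a b p
      induction p with
      | nil => exact id
      | cons hab _ ih => exact fun ha => ih (step _ _ hab ha)
    exact this p ⟨v, rfl, SimpleGraph.Reachable.refl _⟩
  obtain ⟨e, j, hej⟩ := h.node_cover (σ i)
  rw [← hej, ← h.corner] at hu
  by_cases hde : d = e
  · subst hde
    exact hv j (h.inj d hu ▸ hvu)
  · obtain ⟨l, rfl⟩ := h.meet hde hu.symm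
    exact hv l hvu

/-- Invariant along a walk from `ν x`: the current vertex lies in some copy and is joined, inside
that copy, to a terminal whose node is related to `x`. When the walk changes copies the vertex is
itself a terminal of both, so the invariant passes to the new copy. -/
theorem reachable_node_iff (h : IsGluing S τ G φ κ ν) {k : D → SimpleGraph V} {s : D → Fin 5}
    (hs : ∀ d i j, (k d).Reachable (τ i) (τ j) ↔ joins (s d) i j) (x y : X) :
    (gluedGraph φ k).Reachable (ν x) (ν y) ↔ nodeRel κ s x y := by
  have E := nodeRel_equivalence κ s
  have gen : ∀ d i j, (k d).Reachable (τ i) (τ j) → nodeRel κ s (κ d i) (κ d j) :=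
    fun d i j hij => Relation.EqvGen.rel _ _ ⟨d, i, j, rfl, rfl, (hs d i j).1 hij⟩
  constructor
  · have step : ∀ p q, (gluedGraph φ k).Adj p q →
        (∃ d v i, p = φ d v ∧ (k d).Reachable v (τ i) ∧ nodeRel κ s x (κ d i)) →
        ∃ d v i, q = φ d v ∧ (k d).Reachable v (τ i) ∧ nodeRel κ s x (κ d i) := by
      rintro p q hpq ⟨d, v, i, rfl, hv, hx⟩
      obtain ⟨e, a, b, hab, ha, rfl⟩ := h.gluedGraph_adj.1 hpq
      by_cases hde : d = e
      · subst hde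
        rw [h.inj d ha] at hab
        exact ⟨d, b, i, rfl, hab.symm.reachable.trans hv, hx⟩
      · obtain ⟨l, rfl⟩ := h.meet hde ha.symm
        obtain ⟨m, rfl⟩ := h.meet (Ne.symm hde) ha
        refine ⟨e, b, m, rfl, hab.symm.reachable, ?_⟩
        rw [h.corner, h.corner] at ha
        rw [h.node_inj ha]
        exact E.trans hx (E.symm (gen d l i hv))
    rintro ⟨p⟩
    have walk : ∀ {a b : W} (p : (gluedGraph φ k).Walk a b),
        (∃ d v i, a = φ d v ∧ (k d).Reachable v (τ i) ∧ nodeRel κ s x (κ d i)) →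
        ∃ d v i, b = φ d v ∧ (k d).Reachable v (τ i) ∧ nodeRel κ s x (κ d i) := by
      intro a b p
      induction p with
      | nil => exact id
      | cons hab _ ih => exact fun ha => ih (step _ _ hab ha)
    obtain ⟨e, j, rfl⟩ := h.node_cover x
    obtain ⟨d, v, i, hy, hv, hx⟩ := walk p
      ⟨e, τ j, j, (h.corner e j).symm, SimpleGraph.Reachable.refl _, E.refl _⟩
    obtain ⟨e', l, rfl⟩ := h.node_cover y
    rw [← h.corner] at hy
    have hv' : ∃ m, v = τ m := by
      by_cases hde : d = e'
      · subst hde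
        exact ⟨l, (h.inj d hy).symm⟩
      · exact h.meet hde hy.symm
    obtain ⟨m, rfl⟩ := hv'
    rw [h.corner, h.corner] at hy
    rw [h.node_inj hy]
    exact E.trans hx (E.symm (gen d m i hv))
  · intro hxy
    induction hxy with
    | rel x y hxy =>
      obtain ⟨d, i, j, rfl, rfl, hij⟩ := hxy
      rw [← h.corner, ← h.corner]
      exact h.reachable_copy ((hs d i j).2 hij)
    | refl x => exact SimpleGraph.Reachable.refl _
    | symm x y _ ih => exact ih.symm
    | trans x y z _ _ ih1 ih2 => exact ih1.trans ih2

/-- The pattern of a union is a function of the patterns of its parts. This locality turns the graph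
count into a finite sum over pattern assignments. -/
theorem hasPattern_gluedGraph_iff (h : IsGluing S τ G φ κ ν) (k : D → SimpleGraph V)
    (σ : Fin 3 → X) (t : Fin 5) :
    HasPattern (gluedGraph φ k).Reachable (ν ∘ σ) t ↔
      ∃ s : D → Fin 5, (∀ d, HasPattern (k d).Reachable τ (s d)) ∧
        HasPattern (nodeRel κ s) σ t := by
  constructor
  · rintro ⟨hc, ht⟩
    choose s hs using fun d => exists_joins (k d).reachable_is_equivalence τ
    refine ⟨s, fun d => ⟨h.covers_copy hc d, hs d⟩, fun x => ?_, fun i j => ?_⟩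
    · obtain ⟨i, hi⟩ := hc (ν x)
      exact ⟨i, (h.reachable_node_iff hs _ _).1 hi⟩
    · rw [← ht, ← h.reachable_node_iff hs]
      rfl
  · rintro ⟨s, hk, hc, ht⟩
    have hs := fun d => (hk d).2
    refine ⟨fun w => ?_, fun i j => ?_⟩
    · obtain ⟨d, v, rfl⟩ := h.cover w
      obtain ⟨j, hj⟩ := (hk d).1 v
      obtain ⟨i, hi⟩ := hc (κ d j)
      refine ⟨i, (h.reachable_copy hj).trans ?_⟩
      rw [h.corner]
      exact (h.reachable_node_iff hs _ _).2 hi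
    · rw [← ht, ← h.reachable_node_iff hs]
      rfl

open Classical in
/-- Pattern counts of a gluing, as a sum over the patterns of the copies. -/
theorem patternCount_eq [Fintype V] [Fintype D] [DecidableEq D] (h : IsGluing S τ G φ κ ν)
    (σ : Fin 3 → X) (t : Fin 5) :
    patternCount G (ν ∘ σ) t = ∑ s : D → Fin 5,
      if HasPattern (nodeRel κ s) σ t then ∏ d, patternCount S τ (s d) else 0 := by
  let A : Fin 5 → Finset (SimpleGraph V) := fun t =>
    Finset.univ.filter fun K => K ≤ S ∧ HasPattern K.Reachable τ t
  have hA : ∀ t, patternCount S τ t = (A t).card := by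
    intro t
    rw [patternCount, ← Set.ncard_coe_finset]
    simp [A]
  let B : Finset (D → SimpleGraph V) :=
    (Finset.univ.filter fun s => HasPattern (nodeRel κ s) σ t).biUnion
      fun s => Fintype.piFinset fun d => A (s d)
  have hB : {H : SimpleGraph W | H ≤ G ∧ HasPattern H.Reachable (ν ∘ σ) t} =
      gluedGraph φ '' (B : Set (D → SimpleGraph V)) := by
    ext H
    simp only [Set.mem_ofPred_eq, Set.mem_image, Finset.mem_coe, B, Finset.mem_biUnion,
      Finset.mem_filter, Finset.mem_univ, true_and, Fintype.mem_piFinset, A]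
    constructor
    · rintro ⟨hH, hp⟩
      obtain ⟨k, hk, rfl⟩ := h.exists_gluedGraph_eq hH
      obtain ⟨s, hs, hst⟩ := (h.hasPattern_gluedGraph_iff k σ t).1 hp
      exact ⟨k, ⟨s, hst, fun d => ⟨hk d, hs d⟩⟩, rfl⟩
    · rintro ⟨k, ⟨s, hst, hk⟩, rfl⟩
      exact ⟨h.gluedGraph_le fun d => (hk d).1,
        (h.hasPattern_gluedGraph_iff k σ t).2 ⟨s, fun d => (hk d).2, hst⟩⟩
  rw [patternCount, hB, Set.ncard_image_of_injective _ h.gluedGraph_injective,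
    Set.ncard_coe_finset, Finset.card_biUnion, Finset.sum_filter]
  · simp only [Fintype.card_piFinset, hA]
  · intro s _ s' _ hss
    refine Finset.disjoint_left.2 ?_
    intro k hk hk'
    rw [Fintype.mem_piFinset] at hk hk'
    refine hss (funext fun d => ?_)
    have h1 := hk d
    have h2 := hk' d
    simp only [A, Finset.mem_filter] at h1 h2
    exact h1.2.2.unique h2.2.2

end IsGluing

/-! ### Evaluating the sum over patterns of the ten copies

A partition of the fifteen nodes is stored as a list of labels, equal labels meaning equal parts.
The copies are processed one after the other, and a node that no later copy touches is forgotten. -/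

/-- Relabel so that the parts with labels `a`, `b`, `c` are joined according to the pattern. -/
def relabel (a b c : ℕ) (t : Fin 5) (y : ℕ) : ℕ :=
  match t with
  | 0 => bif Nat.beq y a || Nat.beq y b || Nat.beq y c then max a (max b c) else y
  | 1 => bif Nat.beq y a || Nat.beq y b then max a b else y
  | 2 => bif Nat.beq y a || Nat.beq y c then max a c else y
  | 3 => bif Nat.beq y b || Nat.beq y c then max b c else y
  | 4 => y

/-- Join the three nodes of the copy `c` according to the pattern `t`. -/
def joinStep (c : ℕ × ℕ × ℕ) (t : Fin 5) (l : List ℕ) : List ℕ :=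
  l.map (relabel (l.getD c.1 0) (l.getD c.2.1 0) (l.getD c.2.2 0) t)

/-- Every label is the label of an outmost node (nodes `12`, `13`, `14`), and the outmost nodes are
joined according to the pattern `t`. -/
def IsFinal (t : Fin 5) (l : List ℕ) : Prop :=
  (∀ y ∈ l, y = l.getD 12 0 ∨ y = l.getD 13 0 ∨ y = l.getD 14 0) ∧
    ((l.getD 12 0 = l.getD 13 0 ↔ joins t 0 1) ∧ (l.getD 12 0 = l.getD 14 0 ↔ joins t 0 2) ∧
      (l.getD 13 0 = l.getD 14 0 ↔ joins t 1 2))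

instance (t : Fin 5) (l : List ℕ) : Decidable (IsFinal t l) := by
  unfold IsFinal; infer_instance

/-- The weighted number of ways to join the nodes of the copies `cs`, starting from the partition
`l`, that end in the pattern `t`. -/
def total (w : Fin 5 → ℕ) (t : Fin 5) : List (ℕ × ℕ × ℕ) → List ℕ → ℕ
  | [], l => if IsFinal t l then 1 else 0
  | c :: cs, l => ∑ i, w i * total w t cs (joinStep c i l)

/-- Forget the node `v`; `none` when its part has no other node. -/
def forget (v : ℕ) (l : List ℕ) : Option (List ℕ) :=
  bif (l.set v (l.getD 14 0)).any (Nat.beq (l.getD v 0)) then some (l.set v (l.getD 14 0)) else none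

def forgetAll : List ℕ → List ℕ → Option (List ℕ)
  | [], l => some l
  | v :: vs, l =>
    match forget v l with
    | none => none
    | some l' => forgetAll vs l'

def labelsEq : List ℕ → List ℕ → Bool
  | [], [] => true
  | a :: l, b :: l' => bif Nat.beq a b then labelsEq l l' else false
  | _, _ => false

/-- Add the weight `p` to the partition `l` in a weighted list of partitions. -/
def addWeight (l : List ℕ) (p : ℕ) : List (List ℕ × ℕ) → List (List ℕ × ℕ)
  | [] => [(l, p)]
  | e :: d => bif labelsEq l e.1 then (e.1, p + e.2) :: d else e :: addWeight l p d

def addForgotten (vs l : List ℕ) (p : ℕ) (d : List (List ℕ × ℕ)) : List (List ℕ × ℕ) :=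
  match forgetAll vs l with
  | none => d
  | some l' => addWeight l' p d

/-- Process the copy `c`, then forget the nodes `vs`. -/
def advance (w : Fin 5 → ℕ) (c : ℕ × ℕ × ℕ) (vs : List ℕ) :
    List (List ℕ × ℕ) → List (List ℕ × ℕ)
  | [] => []
  | e :: d =>
    addForgotten vs (joinStep c 0 e.1) (e.2 * w 0) <|
    addForgotten vs (joinStep c 1 e.1) (e.2 * w 1) <|
    addForgotten vs (joinStep c 2 e.1) (e.2 * w 2) <|
    addForgotten vs (joinStep c 3 e.1) (e.2 * w 3) <|
    addForgotten vs (joinStep c 4 e.1) (e.2 * w 4) <| advance w c vs d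

def advanceAll (w : Fin 5 → ℕ) :
    List ((ℕ × ℕ × ℕ) × List ℕ) → List (List ℕ × ℕ) → List (List ℕ × ℕ)
  | [], d => d
  | x :: xs, d => advanceAll w xs (advance w x.1 x.2 d)

def readOff (t : Fin 5) : List (List ℕ × ℕ) → ℕ
  | [] => 0
  | e :: d => (if IsFinal t e.1 then e.2 else 0) + readOff t d

/-- The copies in the order in which they are processed, with the nodes forgotten after each. -/
def schedule : List ((ℕ × ℕ × ℕ) × List ℕ) :=
  [((0, 1, 14), []), ((2, 3, 0), [0]), ((3, 4, 1), [1]), ((5, 7, 2), [2]), ((7, 9, 3), [3]),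
   ((9, 11, 4), [4]), ((12, 6, 5), [5]), ((6, 8, 7), [6, 7]), ((8, 10, 9), [8, 9]),
   ((10, 13, 11), [10, 11])]

/-- Joins take maxima, so a part is labelled by its largest node. `schedule` forgets nodes in
increasing order, so this node is still present in every part that keeps a node, and forgotten
places always hold 14. Equal partitions of the remaining nodes thus give equal lists, which
`addWeight` merges. -/
def initialLabels : List ℕ := List.range 15

/-- Weights at which the polynomials are evaluated: the value `2 ^ 24` exceeds all coefficients,
so they can be read off. -/
def kroneckerWeights : Fin 5 → ℕ
  | 0 => 2 ^ (24 * 11)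
  | 1 => 2 ^ 24
  | 2 => 2 ^ 24
  | 3 => 2 ^ 24
  | 4 => 1


/-- Exponents of `f` and `g`, and coefficients, of the monomials of the polynomials that express
the pattern counts of a stage by those of the stage before. -/
def patternTerms : Fin 5 → List (ℕ × ℕ × ℕ)
  | 0 => [(10, 0, 1), (9, 1, 27), (8, 2, 309), (9, 0, 7), (7, 3, 1928), (8, 1, 144), (6, 4, 6936),
      (7, 2, 1140), (8, 0, 15), (5, 5, 13626), (6, 3, 4140), (7, 1, 174), (4, 6, 11354),
      (5, 4, 5856), (6, 2, 516), (7, 0, 2)]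
  | 4 => [(6, 3, 2558), (5, 4, 17763), (4, 5, 61422), (5, 3, 12756), (3, 6, 83234), (4, 4, 30948),
      (6, 2, 1869), (5, 2, 2388), (6, 1, 444), (6, 4, 1068), (5, 5, 7113), (4, 6, 26934),
      (3, 7, 53826), (7, 3, 87), (7, 2, 189), (8, 2, 3), (8, 1, 6), (7, 1, 117), (8, 0, 3),
      (7, 0, 15), (6, 0, 20), (2, 8, 42210)]
  | _ => [(9, 1, 1), (8, 2, 28), (7, 3, 332), (8, 1, 34), (6, 4, 2148), (7, 2, 462), (5, 5, 8015),
      (6, 3, 3130), (7, 1, 142), (4, 6, 16250), (5, 4, 10609), (6, 2, 1095), (9, 0, 1), (8, 0, 6),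
      (7, 0, 12), (4, 5, 14480), (5, 3, 2786), (6, 1, 82), (3, 7, 13732)]

/-- The single large computation: five identities between natural numbers, evaluated by the kernel.
The term list is the same for `t` = 1, 2, 3, so the symmetry between these patterns is verified here
as well. -/
theorem readOff_advanceAll (t : Fin 5) :
    readOff t (advanceAll kroneckerWeights schedule [(initialLabels, 1)]) =
      ((patternTerms t).map fun x => x.2.2 * (2 ^ 24) ^ (11 * x.1 + x.2.1)).sum := by
  revert t
  decide +kernel

/-! ### Correctness of forgetting nodes -/

section

variable {w : Fin 5 → ℕ} {t : Fin 5}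

theorem relabel_eq_or (a b c : ℕ) (t : Fin 5) (y : ℕ) :
    relabel a b c t y = y ∨ ((y = a ∨ y = b ∨ y = c) ∧
      (relabel a b c t y = a ∨ relabel a b c t y = b ∨ relabel a b c t y = c)) := by
  fin_cases t <;> simp only [relabel, Bool.cond_eq_ite, Bool.or_eq_true, Nat.beq_eq] <;> grind

@[simp] theorem length_joinStep (c : ℕ × ℕ × ℕ) (t : Fin 5) (l : List ℕ) :
    (joinStep c t l).length = l.length := by
  simp [joinStep]

theorem getD_joinStep (c : ℕ × ℕ × ℕ) (t : Fin 5) {l : List ℕ} {v : ℕ} (hv : v < l.length) :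
    (joinStep c t l).getD v 0 =
      relabel (l.getD c.1 0) (l.getD c.2.1 0) (l.getD c.2.2 0) t (l.getD v 0) := by
  simp [joinStep, List.getD_eq_getElem?_getD, hv]

theorem getD_set_ne {l : List ℕ} {v u x : ℕ} (h : u ≠ v) :
    (l.set v x).getD u 0 = l.getD u 0 := by
  simp [List.getD_eq_getElem?_getD, List.getElem?_set_ne (Ne.symm h)]

theorem joinStep_set {c : ℕ × ℕ × ℕ} {l : List ℕ} {v : ℕ} (hl : l.length = 15)
    (hc : c.1 ≠ v ∧ c.2.1 ≠ v ∧ c.2.2 ≠ v) (i : Fin 5) :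
    joinStep c i (l.set v (l.getD 14 0)) =
      (joinStep c i l).set v ((joinStep c i l).getD 14 0) := by
  rw [getD_joinStep _ _ (by omega), joinStep, getD_set_ne hc.1, getD_set_ne hc.2.1,
    getD_set_ne hc.2.2, List.map_set, joinStep]

theorem mem_of_mem_set_getD {l : List ℕ} {v y : ℕ} (hl : l.length = 15)
    (h : y ∈ l.set v (l.getD 14 0)) : y ∈ l := by
  rcases List.mem_or_eq_of_mem_set h with h | rfl
  · exact h
  · rw [List.getD_eq_getElem _ _ (by omega)]
    exact List.getElem_mem _

theorem mem_set_of_getD {l : List ℕ} {v u x : ℕ} (hu : u < l.length) (h : u ≠ v) :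
    l.getD u 0 ∈ l.set v x := by
  rw [← getD_set_ne (x := x) h, List.getD_eq_getElem _ _ (by simpa using hu)]
  exact List.getElem_mem _

theorem mem_set_or_eq {l : List ℕ} {v y x : ℕ} (h : y ∈ l) : y ∈ l.set v x ∨ y = l.getD v 0 := by
  obtain ⟨u, hu, rfl⟩ := List.mem_iff_getElem.1 h
  by_cases huv : u = v
  · subst huv
    right
    rw [List.getD_eq_getElem _ _ hu]
  · left
    rw [← List.getD_eq_getElem _ 0 hu]
    exact mem_set_of_getD hu huv

/-- Joins that do not touch `v` commute with overwriting its label, and they preserve whether its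
part has another entry. At the end only the outmost labels matter, so the overwritten entry is
harmless; if `v` was alone in its part, that part never reaches an outmost node and the total is
zero. -/
theorem total_set {v : ℕ} (hv : v < 12) (cs : List (ℕ × ℕ × ℕ))
    (hcs : ∀ c ∈ cs, (c.1 ≠ v ∧ c.2.1 ≠ v ∧ c.2.2 ≠ v) ∧ c.1 < 15 ∧ c.2.1 < 15 ∧ c.2.2 < 15)
    {l : List ℕ} (hl : l.length = 15) :
    total w t cs l = if l.getD v 0 ∈ l.set v (l.getD 14 0) then
      total w t cs (l.set v (l.getD 14 0)) else 0 := by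
  induction cs generalizing l with
  | nil =>
    have h12 : (l.set v (l.getD 14 0)).getD 12 0 = l.getD 12 0 := getD_set_ne (by omega)
    have h13 : (l.set v (l.getD 14 0)).getD 13 0 = l.getD 13 0 := getD_set_ne (by omega)
    have h14 : (l.set v (l.getD 14 0)).getD 14 0 = l.getD 14 0 := getD_set_ne (by omega)
    split_ifs with h
    · have : IsFinal t (l.set v (l.getD 14 0)) ↔ IsFinal t l := by
        rw [IsFinal, IsFinal, h12, h13, h14]
        refine and_congr_left fun _ => ⟨fun H y hy => ?_,
          fun H y hy => H y (mem_of_mem_set_getD hl hy)⟩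
        rcases mem_set_or_eq (v := v) (x := l.getD 14 0) hy with hy | rfl
        · exact H y hy
        · exact H _ h
      simp only [total, this]
    · have : ¬ IsFinal t l := by
        intro H
        have hvl : l.getD v 0 ∈ l := by
          rw [List.getD_eq_getElem _ _ (by omega)]
          exact List.getElem_mem _
        rcases H.1 _ hvl with e | e | e <;> rw [e] at h <;>
          exact h (mem_set_of_getD (by omega) (by omega))
      simp only [total, this, if_false]
  | cons c cs ih =>
    obtain ⟨hc, hlt⟩ := hcs c (by simp)
    have hcs' := fun c' h' => hcs c' (List.mem_cons_of_mem _ h')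
    have hvl : v < l.length := by omega
    have hl' : ∀ i, (joinStep c i l).length = 15 := fun i => by simpa using hl
    split_ifs with h
    · simp only [total]
      refine Finset.sum_congr rfl fun i _ => ?_
      rw [ih hcs' (hl' i), ← joinStep_set hl hc, if_pos]
      rw [getD_joinStep _ _ hvl, joinStep, getD_set_ne hc.1, getD_set_ne hc.2.1,
        getD_set_ne hc.2.2]
      exact List.mem_map_of_mem h
    · simp only [total]
      refine Finset.sum_eq_zero fun i _ => ?_
      rw [ih hcs' (hl' i), ← joinStep_set hl hc, if_neg, mul_zero]
      rw [getD_joinStep _ _ hvl, joinStep, getD_set_ne hc.1, getD_set_ne hc.2.1,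
        getD_set_ne hc.2.2]
      have ha : l.getD c.1 0 ∈ l.set v (l.getD 14 0) := mem_set_of_getD (by omega) hc.1
      have hb : l.getD c.2.1 0 ∈ l.set v (l.getD 14 0) := mem_set_of_getD (by omega) hc.2.1
      have hd : l.getD c.2.2 0 ∈ l.set v (l.getD 14 0) := mem_set_of_getD (by omega) hc.2.2
      generalize l.set v (l.getD 14 0) = l' at *
      generalize l.getD c.1 0 = a at *
      generalize l.getD c.2.1 0 = b at *
      generalize l.getD c.2.2 0 = e at *
      generalize l.getD v 0 = y at *
      -- Here `y` is the label of the isolated node `v`, different from the three labels being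
      -- joined. It is left unchanged, and another label `z` can be sent only to itself or to one of
      -- those three, never to `y`.
      intro hy
      obtain ⟨z, hz, hzy⟩ := List.mem_map.1 hy
      have h1 := relabel_eq_or a b e i y
      have h2 := relabel_eq_or a b e i z
      have hya : y ≠ a := by rintro rfl; exact h ha
      have hyb : y ≠ b := by rintro rfl; exact h hb
      have hye : y ≠ e := by rintro rfl; exact h hd
      have hyz : y ≠ z := by rintro rfl; exact h hz
      rcases h1 with h1 | h1
      · rw [h1] at hzy
        rw [hzy] at h2
        tauto
      · tauto

/-- The weighted sum of the totals of a weighted list of partitions. -/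
def totalSum (w : Fin 5 → ℕ) (t : Fin 5) (cs : List (ℕ × ℕ × ℕ)) :
    List (List ℕ × ℕ) → ℕ
  | [] => 0
  | e :: d => e.2 * total w t cs e.1 + totalSum w t cs d

theorem eq_of_labelsEq {l l' : List ℕ} (h : labelsEq l l' = true) : l = l' := by
  induction l generalizing l' with
  | nil => cases l' <;> simp_all [labelsEq]
  | cons a l ih =>
    cases l' with
    | nil => simp [labelsEq] at h
    | cons b l' =>
      simp only [labelsEq, Bool.cond_eq_ite, Nat.beq_eq, Bool.if_false_right, Bool.and_eq_true,
        decide_eq_true_eq] at h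
      rw [h.1, ih h.2]

theorem totalSum_addWeight (cs : List (ℕ × ℕ × ℕ)) (l : List ℕ) (p : ℕ)
    (d : List (List ℕ × ℕ)) :
    totalSum w t cs (addWeight l p d) = p * total w t cs l + totalSum w t cs d := by
  induction d with
  | nil => rfl
  | cons e d ih =>
    rw [addWeight]
    cases h : labelsEq l e.1 with
    | true => simp only [cond_true, totalSum, eq_of_labelsEq h]; ring
    | false => simp only [cond_false, totalSum, ih]; ring

theorem length_addWeight {l : List ℕ} {p : ℕ} {d : List (List ℕ × ℕ)} (hl : l.length = 15)
    (hd : ∀ e ∈ d, e.1.length = 15) : ∀ e ∈ addWeight l p d, e.1.length = 15 := by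
  induction d with
  | nil => simpa [addWeight] using hl
  | cons e d ih =>
    rw [addWeight]
    obtain ⟨he, hd⟩ := List.forall_mem_cons.1 hd
    cases labelsEq l e.1 with
    | true => exact List.forall_mem_cons.2 ⟨he, hd⟩
    | false => exact List.forall_mem_cons.2 ⟨he, ih hd⟩

/-- The copies `cs` do not touch the nodes `vs`, which are not outmost. -/
def Untouched (vs : List ℕ) (cs : List (ℕ × ℕ × ℕ)) : Prop :=
  ∀ v ∈ vs, v < 12 ∧ ∀ c ∈ cs,
    (c.1 ≠ v ∧ c.2.1 ≠ v ∧ c.2.2 ≠ v) ∧ c.1 < 15 ∧ c.2.1 < 15 ∧ c.2.2 < 15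

instance (vs : List ℕ) (cs : List (ℕ × ℕ × ℕ)) : Decidable (Untouched vs cs) := by
  unfold Untouched; infer_instance

theorem length_forgetAll {vs l l' : List ℕ} (hl : l.length = 15) (h : forgetAll vs l = some l') :
    l'.length = 15 := by
  induction vs generalizing l with
  | nil => simp only [forgetAll, Option.some.injEq] at h; exact h ▸ hl
  | cons v vs ih =>
    rw [forgetAll, forget] at h
    cases hb : (l.set v (l.getD 14 0)).any (Nat.beq (l.getD v 0)) with
    | true =>
      rw [hb] at h
      exact ih (by simpa using hl) h
    | false => rw [hb] at h; simp at h

theorem total_forgetAll {vs l : List ℕ} {cs : List (ℕ × ℕ × ℕ)} (h : Untouched vs cs)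
    (hl : l.length = 15) :
    total w t cs l = match forgetAll vs l with
      | none => 0
      | some l' => total w t cs l' := by
  induction vs generalizing l with
  | nil => rfl
  | cons v vs ih =>
    have hv := h v (by simp)
    rw [total_set hv.1 cs hv.2 hl, forgetAll, forget]
    have hb : (l.set v (l.getD 14 0)).any (Nat.beq (l.getD v 0)) = true ↔
        l.getD v 0 ∈ l.set v (l.getD 14 0) := by
      simp only [List.any_eq_true, Nat.beq_eq]
      exact ⟨fun ⟨x, hx, e⟩ => e ▸ hx, fun h => ⟨_, h, rfl⟩⟩
    by_cases hm : l.getD v 0 ∈ l.set v (l.getD 14 0)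
    · rw [if_pos hm, hb.2 hm, cond_true]
      exact ih (fun v hv => h v (List.mem_cons_of_mem _ hv)) (by simpa using hl)
    · rw [if_neg hm, Bool.eq_false_iff.2 (fun e => hm (hb.1 e)), cond_false]

theorem totalSum_addForgotten {vs l : List ℕ} {cs : List (ℕ × ℕ × ℕ)} (h : Untouched vs cs)
    (hl : l.length = 15) (p : ℕ) (d : List (List ℕ × ℕ)) :
    totalSum w t cs (addForgotten vs l p d) = p * total w t cs l + totalSum w t cs d := by
  rw [total_forgetAll h hl, addForgotten]
  cases forgetAll vs l with
  | none => simp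
  | some l' => exact totalSum_addWeight cs l' p d

theorem length_addForgotten {vs l : List ℕ} {p : ℕ} {d : List (List ℕ × ℕ)} (hl : l.length = 15)
    (hd : ∀ e ∈ d, e.1.length = 15) : ∀ e ∈ addForgotten vs l p d, e.1.length = 15 := by
  rw [addForgotten]
  cases h : forgetAll vs l with
  | none => exact hd
  | some l' => exact length_addWeight (length_forgetAll hl h) hd

theorem length_advance {c : ℕ × ℕ × ℕ} {vs : List ℕ} {d : List (List ℕ × ℕ)}
    (hd : ∀ e ∈ d, e.1.length = 15) : ∀ e ∈ advance w c vs d, e.1.length = 15 := by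
  induction d with
  | nil => simp [advance]
  | cons e d ih =>
    have he : e.1.length = 15 := hd e (by simp)
    have := ih fun e he => hd e (List.mem_cons_of_mem _ he)
    have hj : ∀ i, (joinStep c i e.1).length = 15 := fun i => by simpa using he
    exact length_addForgotten (hj _) <| length_addForgotten (hj _) <|
      length_addForgotten (hj _) <| length_addForgotten (hj _) <| length_addForgotten (hj _) this

/-- The loop invariant of the dynamic programme: expanding one copy into its five patterns,
forgetting nodes and merging equal states leave the weighted total unchanged. -/
theorem totalSum_advance {c : ℕ × ℕ × ℕ} {vs : List ℕ} {cs : List (ℕ × ℕ × ℕ)}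
    (h : Untouched vs cs) {d : List (List ℕ × ℕ)} (hd : ∀ e ∈ d, e.1.length = 15) :
    totalSum w t cs (advance w c vs d) = totalSum w t (c :: cs) d := by
  induction d with
  | nil => rfl
  | cons e d ih =>
    have he : e.1.length = 15 := hd e (by simp)
    have hj : ∀ i, (joinStep c i e.1).length = 15 := fun i => by simpa using he
    rw [advance, totalSum, totalSum_addForgotten h (hj _), totalSum_addForgotten h (hj _),
      totalSum_addForgotten h (hj _), totalSum_addForgotten h (hj _),
      totalSum_addForgotten h (hj _), ih fun e he => hd e (List.mem_cons_of_mem _ he)]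
    simp only [total, Fin.sum_univ_five]
    ring

/-- No copy touches a node that was forgotten before. -/
def ValidSchedule : List ((ℕ × ℕ × ℕ) × List ℕ) → Prop
  | [] => True
  | x :: xs => Untouched x.2 (xs.map Prod.fst) ∧ ValidSchedule xs

theorem readOff_eq (d : List (List ℕ × ℕ)) : readOff t d = totalSum w t [] d := by
  induction d with
  | nil => rfl
  | cons e d ih => simp [readOff, totalSum, total, ih]

theorem totalSum_advanceAll {xs : List ((ℕ × ℕ × ℕ) × List ℕ)} (h : ValidSchedule xs)
    {d : List (List ℕ × ℕ)} (hd : ∀ e ∈ d, e.1.length = 15) :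
    readOff t (advanceAll w xs d) = totalSum w t (xs.map Prod.fst) d := by
  induction xs generalizing d with
  | nil => exact readOff_eq d
  | cons x xs ih =>
    rw [advanceAll, ih h.2 (length_advance hd), totalSum_advance h.1 hd]
    rfl

theorem validSchedule_schedule : ValidSchedule schedule := by
  simp only [schedule, ValidSchedule]
  decide +kernel

theorem total_schedule (t : Fin 5) :
    total kroneckerWeights t (schedule.map Prod.fst) initialLabels =
      ((patternTerms t).map fun x => x.2.2 * (2 ^ 24) ^ (11 * x.1 + x.2.1)).sum := by
  rw [← readOff_advanceAll, totalSum_advanceAll validSchedule_schedule]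
  · simp [totalSum]
  · simp [initialLabels]

end

/-! ### Label lists and the relation between nodes -/

/-- Positions of the ten copies, in the order in which they are processed. -/
def copyPos : Fin 10 → ℕ × ℕ :=
  ![(0, 3), (0, 2), (1, 2), (0, 1), (1, 1), (2, 1), (0, 0), (1, 0), (2, 0), (3, 0)]

/-- Positions of the fifteen nodes; the last three are outmost. -/
def nodePos : Fin 15 → ℕ × ℕ :=
  ![(0, 3), (1, 3), (0, 2), (1, 2), (2, 2), (0, 1), (1, 0), (1, 1), (2, 0), (2, 1), (3, 0), (3, 1),
    (0, 0), (4, 0), (0, 4)]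

/-- The nodes of the ten copies. -/
def copyNode : Fin 10 → Fin 3 → Fin 15 :=
  ![![0, 1, 14], ![2, 3, 0], ![3, 4, 1], ![5, 7, 2], ![7, 9, 3], ![9, 11, 4], ![12, 6, 5],
    ![6, 8, 7], ![8, 10, 9], ![10, 13, 11]]

/-- The outmost nodes. -/
def outmostNode : Fin 3 → Fin 15 := ![12, 13, 14]

/-- The nodes of a copy as numbers. -/
def nodeTriple (κ : Fin 3 → Fin 15) : ℕ × ℕ × ℕ := (κ 0, κ 1, κ 2)

theorem schedule_eq_ofFn :
    schedule.map Prod.fst = List.ofFn fun d => nodeTriple (copyNode d) := by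
  decide +kernel

/-- The partition that results from joining the nodes of all copies. -/
def joinAll : (n : ℕ) → (Fin n → Fin 3 → Fin 15) → (Fin n → Fin 5) → List ℕ → List ℕ
  | 0, _, _, l => l
  | n + 1, κ, s, l => joinAll n (fun d => κ d.succ) (fun d => s d.succ)
      (joinStep (nodeTriple (κ 0)) (s 0) l)

theorem total_ofFn (w : Fin 5 → ℕ) (t : Fin 5) {n : ℕ} (κ : Fin n → Fin 3 → Fin 15) (l : List ℕ) :
    total w t (List.ofFn fun d => nodeTriple (κ d)) l =
      ∑ s : Fin n → Fin 5, if IsFinal t (joinAll n κ s l) then ∏ d, w (s d) else 0 := by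
  induction n generalizing l with
  | zero => simp [total, joinAll]
  | succ n ih =>
    rw [List.ofFn_succ, total, ← (Fin.consEquiv fun _ : Fin (n + 1) => Fin 5).sum_comp,
      Fintype.sum_prod_type]
    refine Finset.sum_congr rfl fun i _ => ?_
    rw [ih, Finset.mul_sum]
    refine Finset.sum_congr rfl fun s _ => ?_
    simp only [Fin.consEquiv_apply, joinAll, Fin.cons_zero, Fin.cons_succ, Fin.prod_univ_succ,
      mul_ite, mul_zero]

theorem length_joinAll {n : ℕ} (κ : Fin n → Fin 3 → Fin 15) (s : Fin n → Fin 5) (l : List ℕ) :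
    (joinAll n κ s l).length = l.length := by
  induction n generalizing l with
  | zero => rfl
  | succ n ih => rw [joinAll, ih, length_joinStep]

/-- The equivalence relation on the nodes that a list of labels stands for. -/
def labelSetoid (l : List ℕ) : Setoid (Fin 15) := Setoid.ker fun x : Fin 15 => l.getD x 0

theorem labelSetoid_apply {l : List ℕ} {x y : Fin 15} :
    labelSetoid l x y ↔ l.getD x 0 = l.getD y 0 := Iff.rfl

theorem relabel_eq_iff (a b c : ℕ) (t : Fin 5) :
    ∀ i j, joins t i j → relabel a b c t (![a, b, c] i) = relabel a b c t (![a, b, c] j) := by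
  fin_cases t <;> intro i j <;> fin_cases i <;> fin_cases j <;>
    simp [joins, relabel]

theorem relabel_eq_joined (a b c : ℕ) (t : Fin 5) (y : ℕ) :
    relabel a b c t y = y ∨ ∃ i j, joins t i j ∧ y = ![a, b, c] i ∧
      relabel a b c t y = ![a, b, c] j := by
  have : ∀ p : Fin 3 → Fin 3 → Prop, (∃ i j, p i j) ↔ (p 0 0 ∨ p 0 1 ∨ p 0 2) ∨
      (p 1 0 ∨ p 1 1 ∨ p 1 2) ∨ (p 2 0 ∨ p 2 1 ∨ p 2 2) := by
    intro p; simp [Fin.exists_fin_succ]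
  rw [this]
  fin_cases t <;> simp [joins, relabel, Bool.cond_eq_ite, Nat.beq_eq] <;> grind

/-- The universal property of a join: the new partition is the least one above the old that contains
the required pairs. In this form joins compose by induction, without describing the generated
equivalence. -/
theorem labelSetoid_joinStep_le {l : List ℕ} (hl : l.length = 15) (κ : Fin 3 → Fin 15) (t : Fin 5)
    (e : Setoid (Fin 15)) :
    labelSetoid (joinStep (nodeTriple κ) t l) ≤ e ↔
      labelSetoid l ≤ e ∧ ∀ i j, joins t i j → e (κ i) (κ j) := by
  have hx : ∀ x : Fin 15, (joinStep (nodeTriple κ) t l).getD x 0 =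
      relabel (l.getD (κ 0) 0) (l.getD (κ 1) 0) (l.getD (κ 2) 0) t (l.getD x 0) :=
    fun x => getD_joinStep _ _ (by omega)
  have hv : ∀ i, ![l.getD (κ 0) 0, l.getD (κ 1) 0, l.getD (κ 2) 0] i = l.getD (κ i) 0 := by
    intro i; fin_cases i <;> rfl
  constructor
  · intro h
    refine ⟨fun x y hxy => h ?_, fun i j hij => h ?_⟩
    · rw [labelSetoid_apply] at hxy ⊢
      rw [hx, hx, hxy]
    · rw [labelSetoid_apply, hx, hx, ← hv i, ← hv j]
      exact relabel_eq_iff _ _ _ t i j hij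
  · rintro ⟨hle, hj⟩ x y hxy
    rw [labelSetoid_apply, hx, hx] at hxy
    have key : ∀ x : Fin 15, ∃ z : Fin 15, e x z ∧ l.getD z 0 =
        relabel (l.getD (κ 0) 0) (l.getD (κ 1) 0) (l.getD (κ 2) 0) t (l.getD x 0) := by
      intro x
      rcases relabel_eq_joined (l.getD (κ 0) 0) (l.getD (κ 1) 0) (l.getD (κ 2) 0) t (l.getD x 0)
        with h | ⟨i, j, hij, h1, h2⟩
      · exact ⟨x, e.refl x, h.symm⟩
      · rw [hv] at h1 h2
        exact ⟨κ j, e.trans (hle h1) (hj i j hij), h2.symm⟩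
    obtain ⟨z, hz, hz'⟩ := key x
    obtain ⟨z', hzy, hzy'⟩ := key y
    have hzz : labelSetoid l z z' := by rw [labelSetoid_apply, hz', hzy', hxy]
    exact e.trans hz (e.trans (hle hzz) (e.symm hzy))

theorem labelSetoid_joinAll_le {n : ℕ} (κ : Fin n → Fin 3 → Fin 15) (s : Fin n → Fin 5)
    {l : List ℕ} (hl : l.length = 15) (e : Setoid (Fin 15)) :
    labelSetoid (joinAll n κ s l) ≤ e ↔
      labelSetoid l ≤ e ∧ ∀ d i j, joins (s d) i j → e (κ d i) (κ d j) := by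
  induction n generalizing l with
  | zero => simp [joinAll]
  | succ n ih =>
    rw [joinAll, ih _ _ (by simpa using hl), labelSetoid_joinStep_le hl, and_assoc]
    exact and_congr_right fun _ => (Fin.forall_fin_succ
      (P := fun d => ∀ i j, joins (s d) i j → e (κ d i) (κ d j))).symm

theorem labelSetoid_initialLabels : labelSetoid initialLabels = ⊥ := by
  rw [eq_bot_iff]
  intro x y hxy
  rw [labelSetoid_apply] at hxy
  simp only [initialLabels, List.getD_eq_getElem?_getD, List.getElem?_range x.2,
    List.getElem?_range y.2, Option.getD_some] at hxy
  exact Fin.ext hxy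

/-- Both sides are the least equivalence relation containing the pairs joined in some copy, as the
initial partition is discrete. -/
theorem nodeRel_iff_joinAll (s : Fin 10 → Fin 5) (x y : Fin 15) :
    nodeRel copyNode s x y ↔ (joinAll 10 copyNode s initialLabels).getD x 0 =
      (joinAll 10 copyNode s initialLabels).getD y 0 := by
  have hl : initialLabels.length = 15 := by simp [initialLabels]
  let e : Setoid (Fin 15) := ⟨nodeRel copyNode s, nodeRel_equivalence _ _⟩
  have h := labelSetoid_joinAll_le copyNode s hl
  constructor
  · intro hxy
    have h' := ((h (labelSetoid (joinAll 10 copyNode s initialLabels))).1 le_rfl).2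
    rw [← labelSetoid_apply]
    induction hxy with
    | rel x y hxy =>
      obtain ⟨d, i, j, rfl, rfl, hij⟩ := hxy
      exact h' d i j hij
    | refl x => exact Setoid.refl' _ x
    | symm x y _ ih => exact Setoid.symm' _ ih
    | trans x y z _ _ ih1 ih2 => exact Setoid.trans' _ ih1 ih2
  · intro hxy
    have : labelSetoid (joinAll 10 copyNode s initialLabels) ≤ e := by
      rw [h, labelSetoid_initialLabels]
      exact ⟨bot_le, fun d i j hij => Relation.EqvGen.rel _ _ ⟨d, i, j, rfl, rfl, hij⟩⟩
    exact this hxy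

theorem hasPattern_nodeRel_iff (s : Fin 10 → Fin 5) (t : Fin 5) :
    HasPattern (nodeRel copyNode s) outmostNode t ↔
      IsFinal t (joinAll 10 copyNode s initialLabels) := by
  have hlen : (joinAll 10 copyNode s initialLabels).length = 15 := by
    rw [length_joinAll]; simp [initialLabels]
  simp only [HasPattern, nodeRel_iff_joinAll, IsFinal]
  generalize joinAll 10 copyNode s initialLabels = l at *
  have o0 : ((outmostNode 0 : Fin 15) : ℕ) = 12 := rfl
  have o1 : ((outmostNode 1 : Fin 15) : ℕ) = 13 := rfl
  have o2 : ((outmostNode 2 : Fin 15) : ℕ) = 14 := rfl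
  refine and_congr ?_ ?_
  · simp only [Fin.exists_fin_succ, Fin.isValue, Fin.succ_zero_eq_one,
      Fin.succ_one_eq_two, o0, o1, o2, IsEmpty.exists_iff, or_false]
    constructor
    · intro h y hy
      obtain ⟨u, hu, rfl⟩ := List.mem_iff_getElem.1 hy
      have := h ⟨u, by omega⟩
      rwa [List.getD_eq_getElem _ _ hu] at this
    · intro h v
      refine h _ ?_
      rw [List.getD_eq_getElem _ _ (by omega)]
      exact List.getElem_mem _
  · have js : ∀ (t : Fin 5) i j, joins t i j ↔ joins t j i := by decide
    have jr : ∀ (t : Fin 5) i, joins t i i := by decide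
    constructor
    · exact fun h => ⟨h 0 1, h 0 2, h 1 2⟩
    · rintro ⟨h1, h2, h3⟩ i j
      fin_cases i <;> fin_cases j <;>
        first
        | exact iff_of_true rfl (jr _ _)
        | assumption
        | (rw [eq_comm, js t]; assumption)

/-! ### From the values at one point to the polynomials -/

theorem eq_of_sum_digits_eq {B : ℕ} (n : ℕ) {a b : ℕ → ℕ} (ha : ∀ e, a e < B) (hb : ∀ e, b e < B)
    (h : ∑ e ∈ Finset.range n, a e * B ^ e = ∑ e ∈ Finset.range n, b e * B ^ e) :
    ∀ e < n, a e = b e := by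
  induction n generalizing a b with
  | zero => simp
  | succ n ih =>
    have hs : ∀ c : ℕ → ℕ, ∑ e ∈ Finset.range (n + 1), c e * B ^ e =
        c 0 + B * ∑ e ∈ Finset.range n, c (e + 1) * B ^ e := by
      intro c
      rw [Finset.sum_range_succ', pow_zero, mul_one, add_comm, Finset.mul_sum]
      congr 1
      exact Finset.sum_congr rfl fun e _ => by rw [pow_succ]; ring
    rw [hs, hs] at h
    have h0 : a 0 = b 0 := by
      have := congrArg (· % B) h
      simpa [Nat.add_mul_mod_self_left, Nat.mod_eq_of_lt (ha 0), Nat.mod_eq_of_lt (hb 0)] using this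
    rw [h0, Nat.add_left_cancel_iff] at h
    have hB : 0 < B := (Nat.zero_le _).trans_lt (ha 0)
    have := ih (fun e => ha (e + 1)) (fun e => hb (e + 1)) (Nat.eq_of_mul_eq_mul_left hB h)
    rintro (_ | e) he
    · exact h0
    · exact this e (by omega)

/-- Exponents of the weights that stand for `f`, `g`, `h`. -/
def exponents : Fin 5 → ℕ × ℕ × ℕ
  | 0 => (1, 0, 0)
  | 4 => (0, 0, 1)
  | _ => (0, 1, 0)

/-- The weights of the patterns, when the three patterns that join one pair have equal weight. -/
def weights (f g h : ℕ) : Fin 5 → ℕ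
  | 0 => f
  | 4 => h
  | _ => g

/-- The three exponents add up to ten, so the exponent of `g` is a valid base 11 digit and the code,
at most 110, determines the monomial. -/
def code (s : Fin 10 → Fin 5) : ℕ :=
  11 * ∑ d, (exponents (s d)).1 + ∑ d, (exponents (s d)).2.1

theorem sum_exponents (s : Fin 10 → Fin 5) : ∑ d, (exponents (s d)).1 + ∑ d, (exponents (s d)).2.1
    + ∑ d, (exponents (s d)).2.2 = 10 := by
  rw [← Finset.sum_add_distrib, ← Finset.sum_add_distrib]
  have : ∀ i, (exponents i).1 + (exponents i).2.1 + (exponents i).2.2 = 1 := by decide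
  simp [this]

/-- The monomial with the given code. -/
def monomial (f g h e : ℕ) : ℕ := f ^ (e / 11) * g ^ (e % 11) * h ^ (10 - e / 11 - e % 11)

theorem prod_weights (f g h : ℕ) (s : Fin 10 → Fin 5) :
    ∏ d, weights f g h (s d) = monomial f g h (code s) := by
  have hw : ∀ i, weights f g h i =
      f ^ (exponents i).1 * g ^ (exponents i).2.1 * h ^ (exponents i).2.2 := by
    intro i; fin_cases i <;> simp [weights, exponents]
  simp only [hw, Finset.prod_mul_distrib, Finset.prod_pow_eq_pow_sum, monomial]
  have := sum_exponents s
  have h1 : code s / 11 = ∑ d, (exponents (s d)).1 := by unfold code; omega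
  have h2 : code s % 11 = ∑ d, (exponents (s d)).2.1 := by unfold code; omega
  rw [h1, h2]
  congr 2
  omega

theorem prod_kroneckerWeights (s : Fin 10 → Fin 5) :
    ∏ d, kroneckerWeights (s d) = (2 ^ 24) ^ code s := by
  have hw : ∀ i, kroneckerWeights i =
      ((2 ^ 24) ^ 11) ^ (exponents i).1 * (2 ^ 24) ^ (exponents i).2.1 := by
    decide +kernel
  simp only [hw, Finset.prod_mul_distrib, Finset.prod_pow_eq_pow_sum, code]
  rw [pow_add, pow_mul]

/-- The coefficient with the given code in a list of terms. -/
def coefficient (l : List (ℕ × ℕ × ℕ)) (e : ℕ) : ℕ :=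
  (l.map fun x => if 11 * x.1 + x.2.1 = e then x.2.2 else 0).sum

theorem sum_coefficient {n : ℕ} {l : List (ℕ × ℕ × ℕ)} (hl : ∀ x ∈ l, 11 * x.1 + x.2.1 < n)
    (F : ℕ → ℕ) :
    ∑ e ∈ Finset.range n, coefficient l e * F e =
      (l.map fun x => x.2.2 * F (11 * x.1 + x.2.1)).sum := by
  induction l with
  | nil => simp [coefficient]
  | cons x l ih =>
    rw [List.map_cons, List.sum_cons, ← ih fun y hy => hl y (List.mem_cons_of_mem _ hy)]
    simp only [coefficient, List.map_cons, List.sum_cons, add_mul, Finset.sum_add_distrib,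
      ite_mul, zero_mul]
    congr 1
    rw [Finset.sum_ite_eq, if_pos (Finset.mem_range.2 (hl x (by simp)))]

theorem coefficient_le (l : List (ℕ × ℕ × ℕ)) (e : ℕ) :
    coefficient l e ≤ (l.map fun x => x.2.2).sum := by
  induction l with
  | nil => simp [coefficient]
  | cons x l ih =>
    simp only [coefficient, List.map_cons, List.sum_cons] at ih ⊢
    split_ifs <;> omega

theorem patternTerms_code_lt (t : Fin 5) : ∀ x ∈ patternTerms t, 11 * x.1 + x.2.1 < 111 := by
  revert t; decide

theorem sum_patternTerms_lt (t : Fin 5) : ((patternTerms t).map fun x => x.2.2).sum < 2 ^ 24 := by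
  revert t; decide

open Classical in
-- Group the assignments by monomial. The group sizes `N e` and the listed coefficients are two base
-- 2 ^ 24 digit sequences of the same number, the value at the Kronecker weights, hence agree; the
-- identity then holds at all weights.
theorem sum_patterns_eq (f g h : ℕ) (t : Fin 5) :
    (∑ s : Fin 10 → Fin 5, if HasPattern (nodeRel copyNode s) outmostNode t then
      ∏ d, weights f g h (s d) else 0) =
      ((patternTerms t).map fun x => x.2.2 * monomial f g h (11 * x.1 + x.2.1)).sum := by
  let N : ℕ → ℕ := fun e => (Finset.univ.filter fun s : Fin 10 → Fin 5 =>
    HasPattern (nodeRel copyNode s) outmostNode t ∧ code s = e).card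
  have hcode : ∀ s, code s < 111 := fun s => by
    have := sum_exponents s
    unfold code; omega
  have hsum : ∀ F : ℕ → ℕ, (∑ s : Fin 10 → Fin 5,
      if HasPattern (nodeRel copyNode s) outmostNode t then F (code s) else 0) =
      ∑ e ∈ Finset.range 111, N e * F e := by
    intro F
    rw [← Finset.sum_filter, ← Finset.sum_fiberwise_of_maps_to (t := Finset.range 111) (g := code)
      fun s _ => Finset.mem_range.2 (hcode s)]
    refine Finset.sum_congr rfl fun e _ => ?_
    rw [Finset.filter_filter, Finset.sum_congr rfl (g := fun _ => F e), Finset.sum_const,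
      smul_eq_mul]
    intro s hs
    rw [(Finset.mem_filter.1 hs).2.2]
  have hN : ∀ e, N e < 2 ^ 24 := by
    intro e
    refine (Finset.card_le_univ _).trans_lt ?_
    -- There are 5 ^ 10 = 9765625 assignments in total, fewer than 2 ^ 24 = 16777216.
    rw [Fintype.card_fun, Fintype.card_fin, Fintype.card_fin]
    norm_num
  have hC : ∀ e, coefficient (patternTerms t) e < 2 ^ 24 := fun e =>
    (coefficient_le _ _).trans_lt (sum_patternTerms_lt t)
  have key := total_schedule t
  rw [schedule_eq_ofFn, total_ofFn] at key
  simp only [← hasPattern_nodeRel_iff, prod_kroneckerWeights] at key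
  rw [hsum fun e => (2 ^ 24) ^ e,
    ← sum_coefficient (patternTerms_code_lt t) fun e => (2 ^ 24) ^ e] at key
  have hNC := eq_of_sum_digits_eq 111 hN hC key
  simp only [prod_weights]
  rw [hsum, ← sum_coefficient (patternTerms_code_lt t)]
  exact Finset.sum_congr rfl fun e he => by rw [hNC e (Finset.mem_range.1 he)]

/-! ### The gasket as a gluing of ten copies of the previous stage -/

/-- The vertices of the gluing are the nodes together with the non-terminal vertices of the copies,
without overlap. -/
theorem IsGluing.card_eq {V W D X : Type*} [Fintype V] [Fintype W] [Fintype D] [Fintype X]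
    {S : SimpleGraph V} {τ : Fin 3 → V} {G : SimpleGraph W} {φ : D → V → W} {κ : D → Fin 3 → X}
    {ν : X → W} (h : IsGluing S τ G φ κ ν) (hτ : Function.Injective τ) :
    Fintype.card W + 3 * Fintype.card D = Fintype.card X + Fintype.card D * Fintype.card V := by
  classical
  let F : X ⊕ D × {v : V // v ∉ Set.range τ} → W := Sum.elim ν fun x => φ x.1 x.2
  have hne : ∀ x d (v : {v : V // v ∉ Set.range τ}), ν x ≠ φ d v := by
    intro x d v hx
    obtain ⟨e, i, rfl⟩ := h.node_cover x
    rw [← h.corner] at hx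
    by_cases hde : d = e
    · subst hde
      exact v.2 ⟨i, h.inj d hx⟩
    · obtain ⟨j, hj⟩ := h.meet hde hx.symm
      exact v.2 ⟨j, hj.symm⟩
  have hF : Function.Bijective F := by
    constructor
    · rintro (x | ⟨d, v⟩) (y | ⟨e, u⟩) hxy
      · exact congrArg _ (h.node_inj hxy)
      · exact absurd hxy (hne _ _ _)
      · exact absurd hxy.symm (hne _ _ _)
      · simp only [F, Sum.elim_inr] at hxy
        by_cases hde : d = e
        · subst hde
          rw [Subtype.ext (h.inj d hxy)]
        · obtain ⟨j, hj⟩ := h.meet hde hxy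
          exact absurd ⟨j, hj.symm⟩ v.2
    · intro w
      obtain ⟨d, u, rfl⟩ := h.cover w
      by_cases hu : u ∈ Set.range τ
      · obtain ⟨i, rfl⟩ := hu
        exact ⟨Sum.inl (κ d i), (h.corner d i).symm⟩
      · exact ⟨Sum.inr (d, ⟨u, hu⟩), rfl⟩
  have h1 := Fintype.card_of_bijective hF
  have h2 : Fintype.card {v : V // v ∉ Set.range τ} + 3 = Fintype.card V := by
    have := Fintype.card_subtype_compl (fun v => v ∈ Set.range τ)
    have h3 : Fintype.card {v : V // v ∈ Set.range τ} = 3 := by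
      exact (Fintype.card_congr (Equiv.ofInjective τ hτ)).symm.trans (Fintype.card_fin 3)
    have h4 := Fintype.card_subtype_le (fun v => v ∈ Set.range τ)
    omega
  rw [← h1, ← h2, Fintype.card_sum, Fintype.card_prod]
  ring

theorem layerCells_four : layerCells 4 = Finset.univ.image copyPos := by decide

theorem copyPos_injective : Function.Injective copyPos := by decide

theorem nodePos_injective : Function.Injective nodePos := by decide

theorem copyNode_cover : ∀ x, ∃ d i, copyNode d i = x := by decide

theorem nodePos_copyNode (d : Fin 10) :
    nodePos (copyNode d 0) = copyPos d ∧
    nodePos (copyNode d 1) = ((copyPos d).1 + 1, (copyPos d).2) ∧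
    nodePos (copyNode d 2) = ((copyPos d).1, (copyPos d).2 + 1) := by
  revert d; decide

/-- Translation by a multiple of `N`. -/
def shift (N : ℕ) (d c : ℕ × ℕ) : ℕ × ℕ := (N * d.1 + c.1, N * d.2 + c.2)

theorem shift_injective (N : ℕ) (d : ℕ × ℕ) : Function.Injective (shift N d) := by
  rintro ⟨a, b⟩ ⟨a', b'⟩ h
  simpa [shift] using h

theorem mem_gasketCells_succ {n : ℕ} {c : ℕ × ℕ} : c ∈ gasketCells 4 (n + 1) ↔
    ∃ d : Fin 10, ∃ c' ∈ gasketCells 4 n, shift (4 ^ n) (copyPos d) c' = c := by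
  simp [gasketCells, layerCells_four, shift]

theorem triangleCorners_shift (N : ℕ) (d c : ℕ × ℕ) :
    triangleCorners (shift N d c) = (triangleCorners c).image (shift N d) := by
  simp [triangleCorners, shift, Finset.image_insert, add_assoc]

theorem mem_gasketVerts_succ {n : ℕ} {p : ℕ × ℕ} : p ∈ gasketVerts 4 (n + 1) ↔
    ∃ d : Fin 10, ∃ p' ∈ gasketVerts 4 n, shift (4 ^ n) (copyPos d) p' = p := by
  simp only [gasketVerts, Finset.mem_biUnion, mem_gasketCells_succ]
  constructor
  · rintro ⟨_, ⟨d, c, hc, rfl⟩, hp⟩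
    rw [triangleCorners_shift, Finset.mem_image] at hp
    obtain ⟨p', hp', rfl⟩ := hp
    exact ⟨d, p', ⟨c, hc, hp'⟩, rfl⟩
  · rintro ⟨d, p', ⟨c, hc, hp'⟩, rfl⟩
    exact ⟨_, ⟨d, c, hc, rfl⟩, by
      rw [triangleCorners_shift]; exact Finset.mem_image_of_mem _ hp'⟩

theorem add_le_of_mem_gasketVerts {n : ℕ} {p : ℕ × ℕ} (hp : p ∈ gasketVerts 4 n) :
    p.1 + p.2 ≤ 4 ^ n := by
  induction n generalizing p with
  | zero =>
    simp only [gasketVerts, gasketCells, triangleCorners, Finset.singleton_biUnion,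
      Finset.mem_insert, Finset.mem_singleton] at hp
    rcases hp with rfl | rfl | rfl <;> simp
  | succ n ih =>
    obtain ⟨d, p', hp', rfl⟩ := mem_gasketVerts_succ.1 hp
    have h1 := ih hp'
    have h2 : (copyPos d).1 + (copyPos d).2 ≤ 3 := by clear hp; revert d; decide
    have h3 := Nat.mul_le_mul_left (4 ^ n) h2
    simp only [shift, pow_succ]
    rw [mul_add] at h3
    omega

/-- Distinct upward triangles of side `N` on the lattice scaled by `N` touch only in corners. The
cases also show that `d` and `e` determine the corner, which gives both `meet` and `meet_unique` of
the gluing. -/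
theorem triangles_meet {N : ℕ} {d e p q : ℕ × ℕ} (hN : 0 < N) (hp : p.1 + p.2 ≤ N)
    (hq : q.1 + q.2 ≤ N) (hde : d ≠ e) (h : shift N d p = shift N e q) :
    (d.1 < e.1 ∧ p.1 = N ∧ p.2 = 0) ∨
    (e.1 < d.1 ∧ p.1 = 0 ∧ N * d.2 + p.2 = N * e.2 ∧ (p.2 = 0 ∨ p.2 = N)) ∨
    (d.1 = e.1 ∧ d.2 < e.2 ∧ p.1 = 0 ∧ p.2 = N) ∨
    (d.1 = e.1 ∧ e.2 < d.2 ∧ p.1 = 0 ∧ p.2 = 0) := by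
  obtain ⟨d1, d2⟩ := d
  obtain ⟨e1, e2⟩ := e
  obtain ⟨x, y⟩ := p
  obtain ⟨x', y'⟩ := q
  simp only [shift, Prod.mk.injEq, ne_eq, not_and] at *
  obtain ⟨h1, h2⟩ := h
  have lt : ∀ {a b : ℕ}, a < b → N * a + N ≤ N * b := fun {a b} hab => by
    rw [← Nat.mul_succ]; exact Nat.mul_le_mul_left N hab
  rcases lt_trichotomy d1 e1 with h3 | rfl | h3
  · have := lt h3
    exact Or.inl ⟨h3, by omega, by omega⟩
  · have h4 := hde rfl
    rcases lt_or_gt_of_ne h4 with h5 | h5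
    · have := lt h5
      exact Or.inr (Or.inr (Or.inl ⟨rfl, h5, by omega, by omega⟩))
    · have := lt h5
      exact Or.inr (Or.inr (Or.inr ⟨rfl, h5, by omega, by omega⟩))
  · have := lt h3
    refine Or.inr (Or.inl ⟨h3, by omega, by omega, ?_⟩)
    rcases lt_trichotomy d2 e2 with h6 | rfl | h6
    · have := lt h6
      omega
    · omega
    · have := lt h6
      omega

/-- The three outmost vertices. -/
def outmost (n : ℕ) : Fin 3 → gasketVerts 4 n := ![leftVertex 4 n, rightVertex 4 n, topVertex 4 n]

theorem outmost_injective (n : ℕ) : Function.Injective (outmost n) := by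
  have hn : (0 : ℕ) ≠ 4 ^ n := by positivity
  intro i j h
  replace h := congrArg Subtype.val h
  fin_cases i <;> fin_cases j <;>
    simp_all [outmost, leftVertex, rightVertex, topVertex]

/-- The copy `d` of stage `n` in stage `n + 1`. -/
def copyVertex (n : ℕ) (d : Fin 10) (p : gasketVerts 4 n) : gasketVerts 4 (n + 1) :=
  ⟨shift (4 ^ n) (copyPos d) p, mem_gasketVerts_succ.2 ⟨d, p, p.2, rfl⟩⟩

theorem copyVertex_outmost (n : ℕ) (d : Fin 10) (i : Fin 3) :
    (copyVertex n d (outmost n i) : ℕ × ℕ) = shift (4 ^ n) (nodePos (copyNode d i)) (0, 0) := by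
  obtain ⟨h0, h1, h2⟩ := nodePos_copyNode d
  fin_cases i <;>
    simp [copyVertex, outmost, leftVertex, rightVertex, topVertex, shift, h0, h1, h2, mul_add]

/-- A corner of a copy of stage `n` in stage `n + 1`. -/
def nodeVertex (n : ℕ) (x : Fin 15) : gasketVerts 4 (n + 1) :=
  ⟨shift (4 ^ n) (nodePos x) (0, 0), by
    obtain ⟨d, i, rfl⟩ := copyNode_cover x
    rw [← copyVertex_outmost]
    exact (copyVertex n d (outmost n i)).2⟩

theorem nodeVertex_outmostNode (n : ℕ) : nodeVertex n ∘ outmostNode = outmost (n + 1) := by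
  funext i
  fin_cases i <;>
    simp [nodeVertex, outmostNode, outmost, leftVertex, rightVertex, topVertex, shift, nodePos,
      pow_succ]

theorem isGluing_gasket (n : ℕ) : IsGluing (gasket 4 n) (outmost n) (gasket 4 (n + 1))
    (copyVertex n) copyNode (nodeVertex n) where
  inj d p q h := Subtype.ext (shift_injective _ _ (congrArg Subtype.val h))
  adj p q := by
    constructor
    · rintro ⟨hpq, c, hc, hp, hq⟩
      obtain ⟨d, c', hc', rfl⟩ := mem_gasketCells_succ.1 hc
      rw [triangleCorners_shift, Finset.mem_image] at hp hq
      obtain ⟨p', hp', hp⟩ := hp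
      obtain ⟨q', hq', hq⟩ := hq
      have mem : ∀ {p}, p ∈ triangleCorners c' → p ∈ gasketVerts 4 n :=
        fun hp => Finset.mem_biUnion.2 ⟨c', hc', hp⟩
      refine ⟨d, ⟨p', mem hp'⟩, ⟨q', mem hq'⟩, ⟨?_, c', hc', hp', hq'⟩, Subtype.ext hp,
        Subtype.ext hq⟩
      intro e
      have e' : p' = q' := congrArg Subtype.val e
      exact hpq (Subtype.ext (by rw [← hp, ← hq, e']))
    · rintro ⟨d, u, v, ⟨huv, c, hc, hu, hv⟩, rfl, rfl⟩
      refine ⟨fun e => huv (Subtype.ext (shift_injective _ _ (congrArg Subtype.val e))),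
        shift (4 ^ n) (copyPos d) c, mem_gasketCells_succ.2 ⟨d, c, hc, rfl⟩, ?_, ?_⟩ <;>
      · rw [triangleCorners_shift]
        exact Finset.mem_image_of_mem _ ‹_›
  meet {d e u v} hde h := by
    have := triangles_meet (by positivity) (add_le_of_mem_gasketVerts u.2)
      (add_le_of_mem_gasketVerts v.2) (copyPos_injective.ne hde) (congrArg Subtype.val h)
    have key : (u.1.1 = 0 ∧ u.1.2 = 0) ∨ (u.1.1 = 4 ^ n ∧ u.1.2 = 0) ∨
        (u.1.1 = 0 ∧ u.1.2 = 4 ^ n) := by omega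
    rcases key with h | h | h
    · exact ⟨0, Subtype.ext (Prod.ext h.1 h.2)⟩
    · exact ⟨1, Subtype.ext (Prod.ext h.1 h.2)⟩
    · exact ⟨2, Subtype.ext (Prod.ext h.1 h.2)⟩
  meet_unique {d e u u' v v'} hde h1 h2 := by
    have m1 := triangles_meet (by positivity) (add_le_of_mem_gasketVerts u.2)
      (add_le_of_mem_gasketVerts u'.2) (copyPos_injective.ne hde) (congrArg Subtype.val h1)
    have m2 := triangles_meet (by positivity) (add_le_of_mem_gasketVerts v.2)
      (add_le_of_mem_gasketVerts v'.2) (copyPos_injective.ne hde) (congrArg Subtype.val h2)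
    generalize 4 ^ n * (copyPos d).2 = a at *
    generalize 4 ^ n * (copyPos e).2 = b at *
    refine Subtype.ext (Prod.ext ?_ ?_) <;> omega
  cover w := by
    obtain ⟨d, p, hp, h⟩ := mem_gasketVerts_succ.1 w.2
    exact ⟨d, ⟨p, hp⟩, Subtype.ext h⟩
  corner d i := Subtype.ext (copyVertex_outmost n d i)
  node_inj x y h := by
    have h' : shift (4 ^ n) (nodePos x) (0, 0) = shift (4 ^ n) (nodePos y) (0, 0) :=
      congrArg Subtype.val h
    have hn : 4 ^ n ≠ 0 := by positivity
    simp only [shift, add_zero, Prod.mk.injEq, Nat.mul_right_inj hn] at h'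
    exact nodePos_injective (Prod.ext h'.1 h'.2)
  node_cover := copyNode_cover

theorem card_gasketVerts (n : ℕ) : 3 * Nat.card (gasketVerts 4 n) = 4 * 10 ^ n + 5 := by
  induction n with
  | zero =>
    rw [Nat.card_eq_fintype_card, Fintype.card_coe]
    decide
  | succ n ih =>
    have h := (isGluing_gasket n).card_eq (outmost_injective n)
    rw [Fintype.card_fin, Fintype.card_fin] at h
    rw [Nat.card_eq_fintype_card] at ih ⊢
    rw [pow_succ]
    omega

/-! ### The stage `0` triangle -/

/-- On three vertices a path has at most two edges. This makes reachability decidable for the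
enumeration of the eight graphs. -/
theorem reachable_fin_three_iff (K : SimpleGraph (Fin 3)) (i j : Fin 3) :
    K.Reachable i j ↔ i = j ∨ K.Adj i j ∨ ∃ k, K.Adj i k ∧ K.Adj k j := by
  constructor
  · rintro ⟨p⟩
    induction p with
    | nil => exact Or.inl rfl
    | @cons u v w huv _ ih =>
      rcases ih with rfl | h | ⟨k, h1, h2⟩
      · exact Or.inr (Or.inl huv)
      · exact Or.inr (Or.inr ⟨v, huv, h⟩)
      · have : ∀ u v k w : Fin 3, u ≠ v → v ≠ k → k ≠ w → u = k ∨ u = w ∨ v = w := by decide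
        rcases this u v k w huv.ne h1.ne h2.ne with rfl | rfl | rfl
        · exact Or.inr (Or.inl h2)
        · exact Or.inl rfl
        · exact Or.inr (Or.inl huv)
  · rintro (rfl | h | ⟨k, h1, h2⟩)
    · exact SimpleGraph.Reachable.refl _
    · exact h.reachable
    · exact h1.reachable.trans h2.reachable

/-- The graph on three points whose edges are opposite to the points selected by `e`. -/
def oppositeGraph (e : Fin 3 → Bool) : SimpleGraph (Fin 3) where
  -- The elements of `Fin 3` sum to 0, so `-(i + j)` is the third point.
  Adj i j := i ≠ j ∧ e (-(i + j)) = true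
  symm := ⟨fun i j h => ⟨h.1.symm, by rw [add_comm]; exact h.2⟩⟩
  loopless := ⟨fun _ h => h.1 rfl⟩

instance (e : Fin 3 → Bool) : DecidableRel (oppositeGraph e).Adj := fun i j => by
  unfold oppositeGraph; infer_instance

theorem oppositeGraph_bijective : Function.Bijective oppositeGraph := by
  have h0 : ∀ k : Fin 3, k + 1 ≠ k + 2 ∧ -(k + 1 + (k + 2)) = k := by decide
  constructor
  · intro e e' h
    have key : ∀ e k, e k = true ↔ (oppositeGraph e).Adj (k + 1) (k + 2) := by
      intro e k
      simp only [oppositeGraph, (h0 k).2, (h0 k).1, ne_eq, not_false_eq_true, true_and]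
    funext k
    rw [Bool.eq_iff_iff, key, key, h]
  · intro K
    classical
    refine ⟨fun k => decide (K.Adj (k + 1) (k + 2)), ?_⟩
    ext i j
    have h1 : ∀ i j : Fin 3, i ≠ j → (-(i + j) + 1 = i ∧ -(i + j) + 2 = j) ∨
      (-(i + j) + 1 = j ∧ -(i + j) + 2 = i) := by decide
    by_cases hij : i = j
    · subst hij
      simp
    · simp only [oppositeGraph, decide_eq_true_eq]
      rcases h1 i j hij with ⟨h2, h3⟩ | ⟨h2, h3⟩ <;> rw [h2, h3] <;> simp [hij, K.adj_comm]

theorem patternCount_fin_three (t : Fin 5) :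
    patternCount (⊤ : SimpleGraph (Fin 3)) id t = weights 4 1 1 t := by
  have h : {K : SimpleGraph (Fin 3) | K ≤ ⊤ ∧ HasPattern K.Reachable id t} =
      oppositeGraph '' (Finset.univ.filter fun e : Fin 3 → Bool => ∀ i j,
        (i = j ∨ (oppositeGraph e).Adj i j ∨
          ∃ k, (oppositeGraph e).Adj i k ∧ (oppositeGraph e).Adj k j) ↔ joins t i j :
        Finset (Fin 3 → Bool)) := by
    ext K
    obtain ⟨e, rfl⟩ := oppositeGraph_bijective.2 K
    rw [oppositeGraph_bijective.1.mem_set_image]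
    simp only [Set.mem_ofPred_eq, le_top, true_and, HasPattern, id, Finset.coe_filter,
      Finset.mem_univ]
    simp only [reachable_fin_three_iff]
    exact and_iff_right fun v => ⟨v, Or.inl rfl⟩
  rw [patternCount, h, Set.ncard_image_of_injective _ oppositeGraph_bijective.1,
    Set.ncard_coe_finset]
  clear h
  revert t
  decide +kernel

theorem patternCount_top {V : Type*} (τ : Fin 3 ≃ V) (t : Fin 5) :
    patternCount (⊤ : SimpleGraph V) τ t = patternCount (⊤ : SimpleGraph (Fin 3)) id t := by
  have h : {K : SimpleGraph (Fin 3) | K ≤ ⊤ ∧ HasPattern K.Reachable id t} =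
      (fun K : SimpleGraph V => K.comap τ) ''
        {K : SimpleGraph V | K ≤ ⊤ ∧ HasPattern K.Reachable τ t} := by
    have hK : ∀ K : SimpleGraph V, HasPattern (K.comap τ).Reachable id t ↔
        HasPattern K.Reachable τ t := by
      intro K
      have hr : ∀ i j, (K.comap τ).Reachable i j ↔ K.Reachable (τ i) (τ j) :=
        fun i j => (SimpleGraph.Iso.reachable_iff (φ := SimpleGraph.Iso.comap τ K)).symm
      simp only [HasPattern, hr, id]
      rw [← τ.forall_congr_right (q := fun v => ∃ i, K.Reachable v (τ i))]
    ext K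
    constructor
    · rintro ⟨_, h⟩
      have hc : (K.comap τ.symm).comap τ = K := by ext i j; simp
      exact ⟨K.comap τ.symm, ⟨le_top, (hK _).1 (by rwa [hc])⟩, hc⟩
    · rintro ⟨K, ⟨_, h⟩, rfl⟩
      exact ⟨le_top, (hK K).2 h⟩
  rw [patternCount, patternCount, h, Set.ncard_image_of_injective]
  intro K K' hKK
  ext u v
  have := congrArg (fun H : SimpleGraph (Fin 3) => H.Adj (τ.symm u) (τ.symm v)) hKK
  simpa using this

theorem patternCount_gasket_zero (t : Fin 5) :
    patternCount (gasket 4 0) (outmost 0) t = weights 4 1 1 t := by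
  have hb : Function.Bijective (outmost 0) := by
    rw [Fintype.bijective_iff_injective_and_card]
    refine ⟨outmost_injective 0, ?_⟩
    rw [Fintype.card_coe]
    decide
  have ht : gasket 4 0 = ⊤ := by
    ext p q
    rw [SimpleGraph.top_adj]
    refine ⟨fun h => h.1, fun h => ⟨h, (0, 0), by simp [gasketCells], ?_, ?_⟩⟩
    · simpa [gasketVerts, gasketCells] using p.2
    · simpa [gasketVerts, gasketCells] using q.2
  rw [ht, ← patternCount_fin_three]
  exact patternCount_top (Equiv.ofBijective _ hb) t

/-! ### The counts as pattern counts -/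

theorem gasketF_eq (n : ℕ) : gasketF 4 n = patternCount (gasket 4 n) (outmost n) 0 := by
  have h : ∀ H : SimpleGraph (gasketVerts 4 n),
      H.Connected ↔ HasPattern H.Reachable (outmost n) 0 := by
    intro H
    constructor
    · intro hc
      exact ⟨fun v => ⟨0, hc.preconnected _ _⟩,
        fun i j => iff_of_true (hc.preconnected _ _) (by simp [joins])⟩
    · rintro ⟨h1, h2⟩
      have : Nonempty (gasketVerts 4 n) := ⟨leftVertex 4 n⟩
      refine ⟨fun u v => ?_⟩
      obtain ⟨i, hi⟩ := h1 u
      obtain ⟨j, hj⟩ := h1 v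
      exact (hi.trans ((h2 i j).2 (by simp [joins]))).trans hj.symm
  simp only [gasketF, numCSSG, patternCount, h]

/-- With exactly two components and two inequivalent outmost vertices, every component contains an
outmost vertex, so the count by components is a pattern count. For `gasketH` the same holds with
three. -/
theorem gasketG_eq (n : ℕ) : gasketG 4 n = patternCount (gasket 4 n) (outmost n) 1 := by
  have h : ∀ H : SimpleGraph (gasketVerts 4 n),
      (Nat.card H.ConnectedComponent = 2 ∧ H.Reachable (leftVertex 4 n) (rightVertex 4 n) ∧
        ¬ H.Reachable (topVertex 4 n) (leftVertex 4 n)) ↔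
      HasPattern H.Reachable (outmost n) 1 := by
    intro H
    constructor
    · rintro ⟨h1, h2, h3⟩
      have h4 : ¬ H.Reachable (topVertex 4 n) (rightVertex 4 n) := fun h => h3 (h.trans h2.symm)
      constructor
      · intro v
        obtain ⟨x, y, hxy, hu⟩ := Nat.card_eq_two_iff.1 h1
        have hm : ∀ v, H.connectedComponentMk v = x ∨ H.connectedComponentMk v = y := by
          intro v
          have : H.connectedComponentMk v ∈ ({x, y} : Set H.ConnectedComponent) := by
            rw [hu]; trivial
          simpa using this
        simp only [← SimpleGraph.ConnectedComponent.eq] at h3 ⊢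
        by_contra! hv
        have h5 := hv 0
        have h6 := hv 2
        simp only [outmost, Matrix.cons_val] at h5 h6
        rcases hm v with e | e <;> rcases hm (topVertex 4 n) with e' | e' <;>
          rcases hm (leftVertex 4 n) with e'' | e'' <;> simp_all
      · intro i j
        fin_cases i <;> fin_cases j <;>
          simp_all [outmost, joins, SimpleGraph.Reachable.symm, SimpleGraph.reachable_comm]
    · rintro ⟨h1, h2⟩
      have h3 : H.Reachable (leftVertex 4 n) (rightVertex 4 n) := (h2 0 1).2 (by decide)
      have h4 : ¬ H.Reachable (topVertex 4 n) (leftVertex 4 n) :=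
        fun h => absurd ((h2 2 0).1 h) (by decide)
      refine ⟨Nat.card_eq_two_iff.2 ⟨H.connectedComponentMk (topVertex 4 n),
        H.connectedComponentMk (leftVertex 4 n), ?_, ?_⟩, h3, h4⟩
      · rwa [Ne, SimpleGraph.ConnectedComponent.eq]
      · rw [Set.eq_univ_iff_forall]
        intro c
        induction c using SimpleGraph.ConnectedComponent.ind with
        | _ v =>
          simp only [Set.mem_insert_iff, Set.mem_singleton_iff, SimpleGraph.ConnectedComponent.eq]
          obtain ⟨i, hi⟩ := h1 v
          fin_cases i
          · exact Or.inr hi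
          · exact Or.inr (hi.trans h3.symm)
          · exact Or.inl hi
  simp only [gasketG, patternCount, h]

theorem gasketH_eq (n : ℕ) : gasketH 4 n = patternCount (gasket 4 n) (outmost n) 4 := by
  have h : ∀ H : SimpleGraph (gasketVerts 4 n),
      (Nat.card H.ConnectedComponent = 3 ∧ ¬ H.Reachable (leftVertex 4 n) (rightVertex 4 n) ∧
        ¬ H.Reachable (topVertex 4 n) (leftVertex 4 n) ∧
        ¬ H.Reachable (topVertex 4 n) (rightVertex 4 n)) ↔
      HasPattern H.Reachable (outmost n) 4 := by
    intro H
    constructor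
    · rintro ⟨h1, h2, h3, h4⟩
      constructor
      · let c : Fin 3 → H.ConnectedComponent := fun i => H.connectedComponentMk (outmost n i)
        have hc : Function.Injective c := by
          intro i j hij
          simp only [c, SimpleGraph.ConnectedComponent.eq] at hij
          fin_cases i <;> fin_cases j <;>
            simp_all [outmost, SimpleGraph.reachable_comm]
        have : Finite H.ConnectedComponent := Nat.finite_of_card_ne_zero (by omega)
        have hs : Function.Surjective c := by
          refine ((Nat.bijective_iff_injective_and_card c).2 ⟨hc, ?_⟩).2
          rw [h1]; simp
        intro v
        obtain ⟨i, hi⟩ := hs (H.connectedComponentMk v)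
        exact ⟨i, (SimpleGraph.ConnectedComponent.eq.1 hi).symm⟩
      · intro i j
        fin_cases i <;> fin_cases j <;>
          simp_all [outmost, joins, SimpleGraph.reachable_comm]
    · rintro ⟨h1, h2⟩
      refine ⟨?_, fun h => absurd ((h2 0 1).1 h) (by decide),
        fun h => absurd ((h2 2 0).1 h) (by decide), fun h => absurd ((h2 2 1).1 h) (by decide)⟩
      let c : Fin 3 → H.ConnectedComponent := fun i => H.connectedComponentMk (outmost n i)
      have hj : ∀ i j, joins 4 i j → i = j := by decide
      have hc : Function.Bijective c := by
        refine ⟨fun i j hij => hj i j ((h2 i j).1 (SimpleGraph.ConnectedComponent.eq.1 hij)), ?_⟩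
        intro x
        induction x using SimpleGraph.ConnectedComponent.ind with
        | _ v =>
          obtain ⟨i, hi⟩ := h1 v
          exact ⟨i, (SimpleGraph.ConnectedComponent.eq.2 hi).symm⟩
      rw [← Nat.card_congr (Equiv.ofBijective c hc)]
      simp
  simp only [gasketH, patternCount, h]

/-! ### The recurrence -/

theorem patternCount_gasket_succ {n f g h : ℕ}
    (hn : ∀ t, patternCount (gasket 4 n) (outmost n) t = weights f g h t) (t : Fin 5) :
    patternCount (gasket 4 (n + 1)) (outmost (n + 1)) t =
      ((patternTerms t).map fun x => x.2.2 * monomial f g h (11 * x.1 + x.2.1)).sum := by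
  classical
  rw [← nodeVertex_outmostNode, (isGluing_gasket n).patternCount_eq, ← sum_patterns_eq]
  simp only [hn]

/-- That the three patterns joining one pair are equally frequent is obtained by induction, not from
automorphisms of the gasket: it holds for the triangle, and the three recurrences have the same
terms. -/
theorem patternCount_gasket (n : ℕ) (t : Fin 5) :
    patternCount (gasket 4 n) (outmost n) t =
      weights (gasketF 4 n) (gasketG 4 n) (gasketH 4 n) t := by
  suffices h : patternCount (gasket 4 n) (outmost n) 2 = patternCount (gasket 4 n) (outmost n) 1 ∧
      patternCount (gasket 4 n) (outmost n) 3 = patternCount (gasket 4 n) (outmost n) 1 by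
    rw [gasketF_eq, gasketG_eq, gasketH_eq]
    match t with
    | 0 => rfl
    | 1 => rfl
    | 2 => exact h.1
    | 3 => exact h.2
    | 4 => rfl
  have key : ∀ n, ∃ f g h, ∀ t, patternCount (gasket 4 n) (outmost n) t = weights f g h t := by
    intro n
    induction n with
    | zero => exact ⟨4, 1, 1, patternCount_gasket_zero⟩
    | succ n ih =>
      obtain ⟨f, g, h, hn⟩ := ih
      let p : Fin 5 → ℕ := fun t =>
        ((patternTerms t).map fun x => x.2.2 * monomial f g h (11 * x.1 + x.2.1)).sum
      refine ⟨p 0, p 1, p 4, fun t => ?_⟩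
      rw [patternCount_gasket_succ hn]
      match t with
      | 0 => rfl
      | 1 => rfl
      | 2 => rfl
      | 3 => rfl
      | 4 => rfl
  obtain ⟨f, g, h, hn⟩ := key n
  simp only [hn]
  exact ⟨rfl, rfl⟩

/-- `polyP` in the variables `a = α` and `r = α / β`. -/
noncomputable def recP (a r : ℝ) : ℝ :=
  11354 + 5856 * r + 516 * r ^ 2 + 2 * r ^ 3 + a * (13626 + 4140 * r + 174 * r ^ 2)
    + a ^ 2 * (6936 + 1140 * r + 15 * r ^ 2) + a ^ 3 * (1928 + 144 * r) + a ^ 4 * (309 + 7 * r)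
    + a ^ 5 * 27 + a ^ 6

/-- `polyQ` in the variables `a = α` and `r = α / β`. -/
noncomputable def recQ (a r : ℝ) : ℝ :=
  13732 + 14480 * r + 2786 * r ^ 2 + 82 * r ^ 3
    + a * (16250 + 10609 * r + 1095 * r ^ 2 + 12 * r ^ 3)
    + a ^ 2 * (8015 + 3130 * r + 142 * r ^ 2) + a ^ 3 * (2148 + 462 * r + 6 * r ^ 2)
    + a ^ 4 * (332 + 34 * r) + a ^ 5 * (28 + r) + a ^ 6

/-- The analogue of `recP` and `recQ` for the numbers `gasketH`. -/
noncomputable def recR (a r : ℝ) : ℝ :=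
  42210 + 83234 * r + 30948 * r ^ 2 + 2388 * r ^ 3 + 20 * r ^ 4
    + a * (53826 + 61422 * r + 12756 * r ^ 2 + 444 * r ^ 3)
    + a ^ 2 * (26934 + 17763 * r + 1869 * r ^ 2 + 15 * r ^ 3)
    + a ^ 3 * (7113 + 2558 * r + 117 * r ^ 2) + a ^ 4 * (1068 + 189 * r + 3 * r ^ 2)
    + a ^ 5 * (87 + 6 * r) + a ^ 6 * 3

theorem polyP_eq (a c : ℝ) : polyP a c = recP a (a / c) := by
  unfold polyP recP; ring

theorem polyQ_eq (a c : ℝ) : polyQ a c = recQ a (a / c) := by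
  unfold polyQ recQ; ring

theorem recurrence_nat (n : ℕ) : ∃ f g h : ℕ, f = gasketF 4 n ∧ g = gasketG 4 n ∧
    h = gasketH 4 n ∧
    gasketF 4 (n + 1) =
      ((patternTerms 0).map fun x => x.2.2 * monomial f g h (11 * x.1 + x.2.1)).sum ∧
    gasketG 4 (n + 1) =
      ((patternTerms 1).map fun x => x.2.2 * monomial f g h (11 * x.1 + x.2.1)).sum ∧
    gasketH 4 (n + 1) =
      ((patternTerms 4).map fun x => x.2.2 * monomial f g h (11 * x.1 + x.2.1)).sum := by
  refine ⟨_, _, _, rfl, rfl, rfl, ?_, ?_, ?_⟩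
  · rw [gasketF_eq, patternCount_gasket_succ (patternCount_gasket n)]
  · rw [gasketG_eq, patternCount_gasket_succ (patternCount_gasket n)]
  · rw [gasketH_eq, patternCount_gasket_succ (patternCount_gasket n)]

theorem gasket_counts_zero : gasketF 4 0 = 4 ∧ gasketG 4 0 = 1 ∧ gasketH 4 0 = 1 := by
  rw [gasketF_eq, gasketG_eq, gasketH_eq]
  simp only [patternCount_gasket_zero]
  exact ⟨rfl, rfl, rfl⟩

theorem gasket_counts_pos (n : ℕ) : 0 < gasketF 4 n ∧ 0 < gasketG 4 n ∧ 0 < gasketH 4 n := by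
  induction n with
  | zero =>
    obtain ⟨h1, h2, h3⟩ := gasket_counts_zero
    omega
  | succ n ih =>
    obtain ⟨f, g, h, hf, hg, hh, h1, h2, h3⟩ := recurrence_nat n
    rw [← hf, ← hg, ← hh] at ih
    obtain ⟨p1, p2, p3⟩ := ih
    have hm : ∀ e, 0 < monomial f g h e := fun e =>
      Nat.mul_pos (Nat.mul_pos (Nat.pow_pos p1) (Nat.pow_pos p2)) (Nat.pow_pos p3)
    have hc : ∀ t, patternTerms t ≠ [] ∧ ∀ x ∈ patternTerms t, 0 < x.2.2 := by decide
    have hs : ∀ t, 0 < ((patternTerms t).map fun x =>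
        x.2.2 * monomial f g h (11 * x.1 + x.2.1)).sum := by
      intro t
      refine List.sum_pos _ ?_ (by simpa using (hc t).1)
      intro y hy
      obtain ⟨x, hx, rfl⟩ := List.mem_map.1 hy
      exact Nat.mul_pos ((hc t).2 x hx) (hm _)
    rw [h1, h2, h3]
    exact ⟨hs 0, hs 1, hs 4⟩

/-- Writing r = fh/g², each monomial of the first polynomial is f⁴g⁶ times a product of powers of
f/g and r, so `h` enters only through r. The prefactors f³g⁷ and f²g⁸ do the same for the other two.
-/
theorem recurrence_real (n : ℕ) {f g h : ℝ} (hf : f = gasketF 4 n) (hg : g = gasketG 4 n)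
    (hh : h = gasketH 4 n) :
    (gasketF 4 (n + 1) : ℝ) = f ^ 4 * g ^ 6 * recP (f / g) (f * h / g ^ 2) ∧
    (gasketG 4 (n + 1) : ℝ) = f ^ 3 * g ^ 7 * recQ (f / g) (f * h / g ^ 2) ∧
    (gasketH 4 (n + 1) : ℝ) = f ^ 2 * g ^ 8 * recR (f / g) (f * h / g ^ 2) := by
  have hg0 : g ≠ 0 := by
    rw [hg]
    exact_mod_cast (gasket_counts_pos n).2.1.ne'
  obtain ⟨f', g', h', hf', hg', hh', h1, h2, h3⟩ := recurrence_nat n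
  rw [← hf'] at hf
  rw [← hg'] at hg
  rw [← hh'] at hh
  rw [h1, h2, h3]
  simp only [patternTerms, List.map_cons, List.map_nil, List.sum_cons, List.sum_nil, monomial,
    Nat.reduceMul, Nat.reduceAdd, Nat.reduceDiv, Nat.reduceMod, Nat.reduceSub]
  push_cast
  rw [← hf, ← hg, ← hh]
  unfold recP recQ recR
  refine ⟨?_, ?_, ?_⟩
  · field_simp
    ring
  · field_simp
    ring
  · field_simp
    ring

/-! ### The two-variable recurrence -/

theorem recP_mono {a a' r r' : ℝ} (ha : 0 ≤ a) (haa : a ≤ a') (hr : 0 ≤ r) (hrr : r ≤ r') :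
    recP a r ≤ recP a' r' := by
  have := ha.trans haa
  have := hr.trans hrr
  unfold recP; gcongr

theorem recQ_mono {a a' r r' : ℝ} (ha : 0 ≤ a) (haa : a ≤ a') (hr : 0 ≤ r) (hrr : r ≤ r') :
    recQ a r ≤ recQ a' r' := by
  have := ha.trans haa
  have := hr.trans hrr
  unfold recQ; gcongr

theorem recR_mono {a a' r r' : ℝ} (ha : 0 ≤ a) (haa : a ≤ a') (hr : 0 ≤ r) (hrr : r ≤ r') :
    recR a r ≤ recR a' r' := by
  have := ha.trans haa
  have := hr.trans hrr
  unfold recR; gcongr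

theorem recP_pos {a r : ℝ} (ha : 0 ≤ a) (hr : 0 ≤ r) : 0 < recP a r := by
  unfold recP; positivity

theorem recQ_pos {a r : ℝ} (ha : 0 ≤ a) (hr : 0 ≤ r) : 0 < recQ a r := by
  unfold recQ; positivity

theorem recR_pos {a r : ℝ} (ha : 0 ≤ a) (hr : 0 ≤ r) : 0 < recR a r := by
  unfold recR; positivity

theorem le_recP {a r : ℝ} (ha : 0 ≤ a) (hr : 3 ≤ r) : 33620 ≤ recP a r := by
  refine le_trans ?_ (recP_mono le_rfl ha (by norm_num) hr)
  norm_num [recP]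

theorem le_recQ {a r : ℝ} (ha : 0 ≤ a) (hr : 3 ≤ r) : 84460 ≤ recQ a r := by
  refine le_trans ?_ (recQ_mono le_rfl ha (by norm_num) hr)
  norm_num [recQ]

theorem recP_le_recQ {a r : ℝ} (ha : 0 ≤ a) (hr : 0 ≤ r) : recP a r ≤ recQ a r := by
  rw [← sub_nonneg]
  unfold recP recQ
  ring_nf
  positivity

/-- This says that r does not increase. After the substitution r = 3 + a/20 + e the difference of
the two sides has only nonnegative coefficients in a and e. -/
theorem recP_mul_recR_le {a r : ℝ} (ha : 0 ≤ a) (hr : 3 + a / 20 ≤ r) :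
    recP a r * recR a r ≤ r * recQ a r ^ 2 := by
  obtain ⟨e, he, rfl⟩ : ∃ e, 0 ≤ e ∧ r = 3 + a / 20 + e := ⟨r - (3 + a / 20), by linarith, by ring⟩
  rw [← sub_nonneg]
  unfold recP recQ recR
  ring_nf
  positivity

/-- At a = 0, r = 3 one has PR = 3Q² exactly. The three constants are the coefficients of a, a², a³
in PR - 3Q² at r = 3. -/
theorem le_recP_mul_recR {a r : ℝ} (ha : 0 ≤ a) (hr : 3 ≤ r) (hr' : r ≤ 4) :
    3 * recQ a r ^ 2 + a * (321732000 + 380271840 * a + 204899064 * a ^ 2) ≤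
      recP a r * recR a r := by
  obtain ⟨x, hx, rfl⟩ : ∃ x, 0 ≤ x ∧ r = 3 + x := ⟨r - 3, by linarith, by ring⟩
  have hx1 : x ≤ 1 := by linarith
  -- The difference has some negative terms in x⁴, x⁵, x⁶. As 0 ≤ x ≤ 1, they are absorbed by the x³
  -- terms with the same power of a; what remains has nonnegative coefficients.
  have m : ∀ i k, 3 ≤ k → 0 ≤ a ^ i * (x ^ 3 - x ^ k) := fun i k hk =>
    mul_nonneg (pow_nonneg ha i) (sub_nonneg.2 (pow_le_pow_of_le_one hx hx1 hk))
  have key : 0 ≤ recP a (3 + x) * recR a (3 + x) - 3 * recQ a (3 + x) ^ 2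
      - a * (321732000 + 380271840 * a + 204899064 * a ^ 2)
      - (102484 * (a ^ 0 * (x ^ 3 - x ^ 4)) + 43296 * (a ^ 0 * (x ^ 3 - x ^ 5))
        + 4236 * (a ^ 0 * (x ^ 3 - x ^ 6)) + 14052 * (a ^ 1 * (x ^ 3 - x ^ 5))
        + 1536 * (a ^ 1 * (x ^ 3 - x ^ 6)) + 3186 * (a ^ 2 * (x ^ 3 - x ^ 5))
        + 102 * (a ^ 2 * (x ^ 3 - x ^ 6)) + 792 * (a ^ 3 * (x ^ 3 - x ^ 5))
        + 61 * (a ^ 4 * (x ^ 3 - x ^ 5)) + 10 * (a ^ 6 * (x ^ 3 - x ^ 4))) := by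
    unfold recP recQ recR
    ring_nf
    positivity
  linarith [m 0 4 (by norm_num), m 0 5 (by norm_num), m 0 6 (by norm_num), m 1 5 (by norm_num),
    m 1 6 (by norm_num), m 2 5 (by norm_num), m 2 6 (by norm_num), m 3 5 (by norm_num),
    m 4 5 (by norm_num), m 6 4 (by norm_num)]

/-- Put r = 3.06 and, in each term containing a, replace all but one factor a by 1.06. -/
theorem recP_le_linear {a r : ℝ} (ha : 0 ≤ a) (ha' : a ≤ 1.06) (hr : 0 ≤ r) (hr' : r ≤ 3.06) :
    recP a r ≤ 34200 + 43000 * a := by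
  calc recP a r ≤ recP a 3.06 := recP_mono ha le_rfl hr hr'
    _ = recP 0 3.06 + a * (13626 + 4140 * 3.06 + 174 * 3.06 ^ 2
        + a * (6936 + 1140 * 3.06 + 15 * 3.06 ^ 2) + a ^ 2 * (1928 + 144 * 3.06)
        + a ^ 3 * (309 + 7 * 3.06) + a ^ 4 * 27 + a ^ 5) := by unfold recP; ring
    _ ≤ recP 0 3.06 + a * (13626 + 4140 * 3.06 + 174 * 3.06 ^ 2
        + 1.06 * (6936 + 1140 * 3.06 + 15 * 3.06 ^ 2) + 1.06 ^ 2 * (1928 + 144 * 3.06)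
        + 1.06 ^ 3 * (309 + 7 * 3.06) + 1.06 ^ 4 * 27 + 1.06 ^ 5) := by gcongr
    _ ≤ recP 0 3.06 + a * 43000 := by gcongr; norm_num
    _ ≤ 34200 + 43000 * a := by norm_num [recP]; linarith

theorem recQ_le_linear {a r : ℝ} (ha : 0 ≤ a) (ha' : a ≤ 1.06) (hr : 0 ≤ r) (hr' : r ≤ 3.06) :
    recQ a r ≤ 87000 + 86000 * a := by
  calc recQ a r ≤ recQ a 3.06 := recQ_mono ha le_rfl hr hr'
    _ = recQ 0 3.06 + a * (16250 + 10609 * 3.06 + 1095 * 3.06 ^ 2 + 12 * 3.06 ^ 3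
        + a * (8015 + 3130 * 3.06 + 142 * 3.06 ^ 2) + a ^ 2 * (2148 + 462 * 3.06 + 6 * 3.06 ^ 2)
        + a ^ 3 * (332 + 34 * 3.06) + a ^ 4 * (28 + 3.06) + a ^ 5) := by unfold recQ; ring
    _ ≤ recQ 0 3.06 + a * (16250 + 10609 * 3.06 + 1095 * 3.06 ^ 2 + 12 * 3.06 ^ 3
        + 1.06 * (8015 + 3130 * 3.06 + 142 * 3.06 ^ 2)
        + 1.06 ^ 2 * (2148 + 462 * 3.06 + 6 * 3.06 ^ 2)
        + 1.06 ^ 3 * (332 + 34 * 3.06) + 1.06 ^ 4 * (28 + 3.06) + 1.06 ^ 5) := by gcongr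
    _ ≤ recQ 0 3.06 + a * 86000 := by gcongr; norm_num
    _ ≤ 87000 + 86000 * a := by norm_num [recQ]; linarith

/-- A region that the recurrence maps into itself and on which both variables decrease. -/
structure InRegion (a r : ℝ) : Prop where
  pos : 0 < a
  le : a ≤ 1.06
  add_le : 3 + a / 20 ≤ r
  le' : r ≤ 3.06

/-- The variable a decreases because P ≤ Q, and r because r ≥ 3 + a/20. To keep the latter for the
new values, where a' = aP/Q, one needs PR ≥ 3Q² + (a/20)PQ. The linear bounds on P and Q make the
last term at most a times a quadratic, which `le_recP_mul_recR` dominates coefficient by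
coefficient. -/
theorem InRegion.next {a r : ℝ} (h : InRegion a r) :
    InRegion (a * recP a r / recQ a r) (recP a r * recR a r / recQ a r ^ 2) ∧
      a * recP a r / recQ a r ≤ a ∧ recP a r * recR a r / recQ a r ^ 2 ≤ r := by
  have ha := h.pos.le
  have hr : 0 ≤ r := by linarith [h.add_le]
  have hP := recP_pos ha hr
  have hQ := recQ_pos ha hr
  have h1 : a * recP a r / recQ a r ≤ a := by
    rw [div_le_iff₀ hQ]
    exact mul_le_mul_of_nonneg_left (recP_le_recQ ha hr) ha
  have h2 : recP a r * recR a r / recQ a r ^ 2 ≤ r := by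
    rw [div_le_iff₀ (by positivity)]
    exact recP_mul_recR_le ha h.add_le
  have hp := h.pos
  refine ⟨⟨by positivity, h1.trans h.le, ?_, h2.trans h.le'⟩, h1, h2⟩
  rw [le_div_iff₀ (by positivity)]
  have h3 := le_recP_mul_recR ha (by linarith [h.add_le]) (h.le'.trans (by norm_num))
  have h4 : a / 20 * (recP a r * recQ a r) ≤
      a * (321732000 + 380271840 * a + 204899064 * a ^ 2) := by
    calc a / 20 * (recP a r * recQ a r)
        ≤ a / 20 * ((34200 + 43000 * a) * (87000 + 86000 * a)) := by
          gcongr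
          · exact recP_le_linear ha h.le hr h.le'
          · exact recQ_le_linear ha h.le hr h.le'
      _ = a * (148770000 + 334110000 * a + 184900000 * a ^ 2) := by ring
      _ ≤ _ := by gcongr <;> norm_num
  have h5 : (3 + a * recP a r / recQ a r / 20) * recQ a r ^ 2 =
      3 * recQ a r ^ 2 + a / 20 * (recP a r * recQ a r) := by
    field_simp
  linarith

/-- Bounds for one step of the recurrence. -/
theorem step_bounds {a r al ah rl rh : ℝ} (h0 : 0 ≤ al) (h0' : 0 ≤ rl)
    (h : (al ≤ a ∧ a ≤ ah) ∧ rl ≤ r ∧ r ≤ rh) :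
    (al * recP al rl / recQ ah rh ≤ a * recP a r / recQ a r ∧
      a * recP a r / recQ a r ≤ ah * recP ah rh / recQ al rl) ∧
    recP al rl * recR al rl / recQ ah rh ^ 2 ≤ recP a r * recR a r / recQ a r ^ 2 ∧
      recP a r * recR a r / recQ a r ^ 2 ≤ recP ah rh * recR ah rh / recQ al rl ^ 2 := by
  obtain ⟨⟨h1, h2⟩, h3, h4⟩ := h
  have ha := h0.trans h1
  have hr := h0'.trans h3
  have hah := ha.trans h2
  have hrh := hr.trans h4
  have p1 := recP_mono h0 h1 h0' h3
  have p2 := recP_mono ha h2 hr h4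
  have q1 := recQ_mono h0 h1 h0' h3
  have q2 := recQ_mono ha h2 hr h4
  have r1 := recR_mono h0 h1 h0' h3
  have r2 := recR_mono ha h2 hr h4
  have P0 := recP_pos h0 h0'
  have Q0 := recQ_pos h0 h0'
  have R0 := recR_pos h0 h0'
  have P1 := recP_pos ha hr
  have Q1 := recQ_pos ha hr
  have R1 := recR_pos ha hr
  have P2 := recP_pos hah hrh
  have Q2 := recQ_pos hah hrh
  have R2 := recR_pos hah hrh
  refine ⟨⟨?_, ?_⟩, ?_, ?_⟩ <;> gcongr

/-! ### The sequences α and α/β -/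

/-- `α` at stage `n`. -/
noncomputable def alpha (n : ℕ) : ℝ := gasketAlpha 4 n

/-- `α / β` at stage `n`. -/
noncomputable def rho (n : ℕ) : ℝ := gasketAlpha 4 n / gasketBeta 4 n

theorem rho_eq (n : ℕ) : rho n = (gasketF 4 n : ℝ) * gasketH 4 n / (gasketG 4 n : ℝ) ^ 2 := by
  obtain ⟨h1, h2, h3⟩ := gasket_counts_pos n
  unfold rho gasketAlpha gasketBeta
  field_simp

theorem alpha_zero : alpha 0 = 4 := by
  obtain ⟨h1, h2, h3⟩ := gasket_counts_zero
  simp [alpha, gasketAlpha, h1, h2]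

theorem rho_zero : rho 0 = 4 := by
  obtain ⟨h1, h2, h3⟩ := gasket_counts_zero
  simp [rho_eq, h1, h2, h3]

theorem alpha_succ (n : ℕ) :
    alpha (n + 1) = alpha n * recP (alpha n) (rho n) / recQ (alpha n) (rho n) := by
  obtain ⟨h1, h2, -⟩ := recurrence_real n rfl rfl rfl
  obtain ⟨p1, p2, p3⟩ := gasket_counts_pos n
  rw [rho_eq]
  unfold alpha gasketAlpha
  rw [h1, h2]
  have := recQ_pos (a := (gasketF 4 n : ℝ) / gasketG 4 n)
    (r := (gasketF 4 n : ℝ) * gasketH 4 n / (gasketG 4 n : ℝ) ^ 2) (by positivity) (by positivity)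
  generalize recQ _ _ = q at *
  generalize recP _ _ = p at *
  field_simp

theorem rho_succ (n : ℕ) : rho (n + 1) =
    recP (alpha n) (rho n) * recR (alpha n) (rho n) / recQ (alpha n) (rho n) ^ 2 := by
  obtain ⟨h1, h2, h3⟩ := recurrence_real n rfl rfl rfl
  obtain ⟨p1, p2, p3⟩ := gasket_counts_pos n
  rw [rho_eq, rho_eq]
  unfold alpha gasketAlpha
  rw [h1, h2, h3]
  have := recQ_pos (a := (gasketF 4 n : ℝ) / gasketG 4 n)
    (r := (gasketF 4 n : ℝ) * gasketH 4 n / (gasketG 4 n : ℝ) ^ 2) (by positivity) (by positivity)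
  generalize recQ _ _ = q at *
  generalize recP _ _ = p at *
  generalize recR _ _ = s at *
  field_simp

theorem bounds_one : (2.114336221311232 ≤ alpha 1 ∧ alpha 1 ≤ 2.114336221311233) ∧
    3.073870623721891 ≤ rho 1 ∧ rho 1 ≤ 3.073870623721892 := by
  rw [alpha_succ, rho_succ, alpha_zero, rho_zero]
  norm_num [recP, recQ, recR]

theorem bounds_two : (1.057057072111335 ≤ alpha 2 ∧ alpha 2 ≤ 1.057057072111339) ∧
    3.057834547321702 ≤ rho 2 ∧ rho 2 ≤ 3.057834547321713 := by
  obtain ⟨⟨h1, h2⟩, h3, h4⟩ := step_bounds (by norm_num) (by norm_num) bounds_one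
  rw [← alpha_succ] at h1 h2
  rw [← rho_succ] at h3 h4
  refine ⟨⟨h1.trans' ?_, h2.trans ?_⟩, h3.trans' ?_, h4.trans ?_⟩ <;> norm_num [recP, recQ, recR]

theorem bounds_three : (0.475214294459898 ≤ alpha 3 ∧ alpha 3 ≤ 0.475214294459907) ∧
    3.038207564862235 ≤ rho 3 ∧ rho 3 ≤ 3.038207564862312 := by
  obtain ⟨⟨h1, h2⟩, h3, h4⟩ := step_bounds (by norm_num) (by norm_num) bounds_two
  rw [← alpha_succ] at h1 h2
  rw [← rho_succ] at h3 h4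
  refine ⟨⟨h1.trans' ?_, h2.trans ?_⟩, h3.trans' ?_, h4.trans ?_⟩ <;> norm_num [recP, recQ, recR]

theorem bounds_four : (0.199993476915301 ≤ alpha 4 ∧ alpha 4 ≤ 0.199993476915318) ∧
    3.019790750327749 ≤ rho 4 ∧ rho 4 ≤ 3.019790750328162 := by
  obtain ⟨⟨h1, h2⟩, h3, h4⟩ := step_bounds (by norm_num) (by norm_num) bounds_three
  rw [← alpha_succ] at h1 h2
  rw [← rho_succ] at h3 h4
  refine ⟨⟨h1.trans' ?_, h2.trans ?_⟩, h3.trans' ?_, h4.trans ?_⟩ <;> norm_num [recP, recQ, recR]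

theorem bounds_five : (0.081497288071524 ≤ alpha 5 ∧ alpha 5 ≤ 0.081497288071556) ∧
    3.00887828418118 ≤ rho 5 ∧ rho 5 ≤ 3.008878284183221 := by
  obtain ⟨⟨h1, h2⟩, h3, h4⟩ := step_bounds (by norm_num) (by norm_num) bounds_four
  rw [← alpha_succ] at h1 h2
  rw [← rho_succ] at h3 h4
  refine ⟨⟨h1.trans' ?_, h2.trans ?_⟩, h3.trans' ?_, h4.trans ?_⟩ <;> norm_num [recP, recQ, recR]

/-- The region is entered at stage 2; at stage 1, α is about 2.11 and still too large. -/
theorem inRegion (n : ℕ) : InRegion (alpha (n + 2)) (rho (n + 2)) := by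
  induction n with
  | zero =>
    obtain ⟨⟨h1, h2⟩, h3, h4⟩ := bounds_two
    rw [zero_add]
    constructor <;> linarith
  | succ n ih =>
    have h := ih.next.1
    rwa [← alpha_succ, ← rho_succ] at h

theorem alpha_pos (n : ℕ) : 0 < alpha n := by
  obtain ⟨h1, h2, h3⟩ := gasket_counts_pos n
  unfold alpha gasketAlpha
  positivity

theorem alpha_antitone : Antitone alpha := by
  refine antitone_nat_of_succ_le fun n => ?_
  match n with
  | 0 => rw [alpha_zero]; linarith [bounds_one.1.2]
  | 1 => linarith [bounds_one.1.1, bounds_two.1.2]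
  | n + 2 =>
    have := (inRegion n).next.2.1
    rwa [← alpha_succ] at this

theorem rho_antitone : Antitone rho := by
  refine antitone_nat_of_succ_le fun n => ?_
  match n with
  | 0 => rw [rho_zero]; linarith [bounds_one.2.2]
  | 1 => linarith [bounds_one.2.1, bounds_two.2.2]
  | n + 2 =>
    have := (inRegion n).next.2.2
    rwa [← rho_succ] at this

theorem three_le_rho (n : ℕ) : 3 ≤ rho n := by
  match n with
  | 0 => rw [rho_zero]; norm_num
  | 1 => linarith [bounds_one.2.1]
  | n + 2 => linarith [(inRegion n).add_le, (inRegion n).pos]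

/-- `P` at stage `n`. -/
noncomputable def stageP (n : ℕ) : ℝ := recP (alpha n) (rho n)

/-- `Q` at stage `n`. -/
noncomputable def stageQ (n : ℕ) : ℝ := recQ (alpha n) (rho n)

theorem stageP_antitone : Antitone stageP := fun _ n h =>
  recP_mono (alpha_pos n).le (alpha_antitone h) ((three_le_rho n).trans' (by norm_num))
    (rho_antitone h)

theorem stageQ_antitone : Antitone stageQ := fun _ n h =>
  recQ_mono (alpha_pos n).le (alpha_antitone h) ((three_le_rho n).trans' (by norm_num))
    (rho_antitone h)

theorem le_stageP (n : ℕ) : 33620 ≤ stageP n := le_recP (alpha_pos n).le (three_le_rho n)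

theorem le_stageQ (n : ℕ) : 84460 ≤ stageQ n := le_recQ (alpha_pos n).le (three_le_rho n)

/-! ### Convergence of the logarithms -/

/-- The increment `ln P + 2 ln Q` at stage `n`. -/
noncomputable def increment (n : ℕ) : ℝ := Real.log (stageP n) + 2 * Real.log (stageQ n)

/-- `ln f + 2 ln g` at stage `n`. -/
noncomputable def logSum (n : ℕ) : ℝ :=
  Real.log (gasketF 4 n : ℝ) + 2 * Real.log (gasketG 4 n : ℝ)

theorem increment_antitone : Antitone increment := by
  intro m n h
  have h1 := le_stageP n
  have h2 := le_stageQ n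
  unfold increment
  gcongr
  · exact stageP_antitone h
  · exact stageQ_antitone h

theorem le_increment (n : ℕ) : Real.log 33620 + 2 * Real.log 84460 ≤ increment n := by
  unfold increment
  gcongr
  · exact le_stageP n
  · exact le_stageQ n

theorem increment_nonneg (n : ℕ) : 0 ≤ increment n :=
  (le_increment n).trans' (by positivity)

theorem logSum_zero : logSum 0 = Real.log 4 := by
  obtain ⟨h1, h2, -⟩ := gasket_counts_zero
  simp [logSum, h1, h2]

theorem logSum_succ (n : ℕ) : logSum (n + 1) = 10 * logSum n + increment n := by
  obtain ⟨h1, h2, -⟩ := recurrence_real n rfl rfl rfl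
  obtain ⟨p1, p2, p3⟩ := gasket_counts_pos n
  have hP : (0 : ℝ) < stageP n := (le_stageP n).trans_lt' (by norm_num)
  have hQ : (0 : ℝ) < stageQ n := (le_stageQ n).trans_lt' (by norm_num)
  rw [← rho_eq] at h1 h2
  change _ = _ * stageP n at h1
  change _ = _ * stageQ n at h2
  have q1 : (gasketF 4 n : ℝ) ≠ 0 := by positivity
  have q2 : (gasketG 4 n : ℝ) ≠ 0 := by positivity
  unfold logSum increment
  rw [h1, h2, Real.log_mul (by positivity) hP.ne', Real.log_mul (by positivity) hQ.ne',
    Real.log_mul (by positivity) (by positivity), Real.log_mul (by positivity) (by positivity),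
    Real.log_pow, Real.log_pow, Real.log_pow, Real.log_pow]
  push_cast
  ring

theorem log_alpha (n : ℕ) :
    Real.log (alpha n) = Real.log (gasketF 4 n : ℝ) - Real.log (gasketG 4 n : ℝ) := by
  obtain ⟨p1, p2, p3⟩ := gasket_counts_pos n
  exact Real.log_div (by positivity) (by positivity)

/-- Each step changes ln α by ln P - ln Q, which is bounded by the increment since both logarithms
are nonnegative. The linear bound suffices, as ln α is later divided by 10ⁿ. -/
theorem abs_log_alpha_le (n : ℕ) : |Real.log (alpha n)| ≤ Real.log 4 + n * increment 0 := by
  induction n with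
  | zero =>
    rw [alpha_zero, abs_of_nonneg (Real.log_nonneg (by norm_num))]
    simp
  | succ n ih =>
    have hP : (0 : ℝ) < stageP n := (le_stageP n).trans_lt' (by norm_num)
    have hQ : (0 : ℝ) < stageQ n := (le_stageQ n).trans_lt' (by norm_num)
    have h : Real.log (alpha (n + 1)) =
        Real.log (alpha n) + (Real.log (stageP n) - Real.log (stageQ n)) := by
      rw [alpha_succ]
      change Real.log (alpha n * stageP n / stageQ n) = _
      rw [Real.log_div (mul_pos (alpha_pos n) hP).ne' hQ.ne',
        Real.log_mul (alpha_pos n).ne' hP.ne']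
      ring
    have h1 : 0 ≤ Real.log (stageP n) := Real.log_nonneg ((le_stageP n).trans' (by norm_num))
    have h2 : 0 ≤ Real.log (stageQ n) := Real.log_nonneg ((le_stageQ n).trans' (by norm_num))
    have h3 : increment n ≤ increment 0 := increment_antitone (Nat.zero_le n)
    have h4 : |Real.log (stageP n) - Real.log (stageQ n)| ≤ increment 0 := by
      rw [increment] at h3
      rw [abs_le]
      constructor <;> linarith
    rw [h]
    refine (abs_add_le _ _).trans ?_
    push_cast
    linarith

/-- `(ln f + 2 ln g) / 10 ^ n` at stage `n`. -/
noncomputable def scaledLog (n : ℕ) : ℝ := logSum n / 10 ^ n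

theorem scaledLog_succ (n : ℕ) : scaledLog (n + 1) = scaledLog n + increment n / 10 ^ (n + 1) := by
  unfold scaledLog
  rw [logSum_succ, pow_succ]
  field_simp

theorem scaledLog_monotone : Monotone scaledLog := by
  refine monotone_nat_of_le_succ fun n => ?_
  rw [scaledLog_succ]
  have := increment_nonneg n
  have : 0 ≤ increment n / 10 ^ (n + 1) := by positivity
  linarith

/-- The increments from stage `m` on are at most `increment m`, and the sum of 10⁻ʲ for m < j ≤ m +
k is (10⁻ᵐ - 10⁻⁽ᵐ⁺ᵏ⁾)/9. -/
theorem scaledLog_add_le (m k : ℕ) :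
    scaledLog (m + k) ≤ scaledLog m + increment m / 9 * (1 / 10 ^ m - 1 / 10 ^ (m + k)) := by
  induction k with
  | zero => simp
  | succ k ih =>
    rw [← add_assoc, scaledLog_succ]
    have h : increment (m + k) / 10 ^ (m + k + 1) ≤ increment m / 10 ^ (m + k + 1) := by
      gcongr
      exact increment_antitone (Nat.le_add_right m k)
    have h2 : increment m / 9 * (1 / 10 ^ m - 1 / 10 ^ (m + k)) + increment m / 10 ^ (m + k + 1) =
        increment m / 9 * (1 / 10 ^ m - 1 / 10 ^ (m + k + 1)) := by
      rw [pow_succ 10 (m + k)]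
      field_simp
      ring
    linarith

theorem le_scaledLog_add (m k : ℕ) :
    scaledLog m + (Real.log 33620 + 2 * Real.log 84460) / 9 * (1 / 10 ^ m - 1 / 10 ^ (m + k)) ≤
      scaledLog (m + k) := by
  induction k with
  | zero => simp
  | succ k ih =>
    rw [← add_assoc, scaledLog_succ]
    set c := Real.log 33620 + 2 * Real.log 84460 with hc
    have h : c / 10 ^ (m + k + 1) ≤ increment (m + k) / 10 ^ (m + k + 1) := by
      gcongr
      exact le_increment _
    have h2 : c / 9 * (1 / 10 ^ m - 1 / 10 ^ (m + k)) + c / 10 ^ (m + k + 1) =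
        c / 9 * (1 / 10 ^ m - 1 / 10 ^ (m + k + 1)) := by
      rw [pow_succ 10 (m + k)]
      field_simp
      ring
    linarith

theorem tendsto_one_div_ten_pow (m : ℕ) :
    Tendsto (fun k : ℕ => (1 : ℝ) / 10 ^ (m + k)) atTop (𝓝 0) := by
  have h : Tendsto (fun k : ℕ => ((1 : ℝ) / 10) ^ k) atTop (𝓝 0) :=
    tendsto_pow_atTop_nhds_zero_of_lt_one (by norm_num) (by norm_num)
  have := h.comp (tendsto_add_atTop_nat m)
  refine this.congr fun k => ?_
  simp [add_comm]

theorem exists_tendsto_scaledLog : ∃ T, Tendsto scaledLog atTop (𝓝 T) ∧ ∀ m,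
    scaledLog m + (Real.log 33620 + 2 * Real.log 84460) / 9 * (1 / 10 ^ m) ≤ T ∧
      T ≤ scaledLog m + increment m / 9 * (1 / 10 ^ m) := by
  have hb : BddAbove (Set.range scaledLog) := by
    refine ⟨scaledLog 0 + increment 0 / 9, ?_⟩
    rintro _ ⟨n, rfl⟩
    have h := scaledLog_add_le 0 n
    have h1 := increment_nonneg 0
    have h2 : increment 0 / 9 * (1 / 10 ^ 0 - 1 / 10 ^ (0 + n)) ≤ increment 0 / 9 * 1 := by
      gcongr
      have : (0 : ℝ) ≤ 1 / 10 ^ (0 + n) := by positivity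
      linarith
    rw [zero_add] at h h2
    linarith
  have hT := tendsto_atTop_ciSup scaledLog_monotone hb
  refine ⟨_, hT, fun m => ?_⟩
  have hm : Tendsto (fun k => scaledLog (m + k)) atTop (𝓝 (⨆ i, scaledLog i)) := by
    refine (hT.comp (tendsto_add_atTop_nat m)).congr fun k => ?_
    simp [add_comm]
  have hs : ∀ c : ℝ, Tendsto (fun k : ℕ => scaledLog m + c * (1 / 10 ^ m - 1 / 10 ^ (m + k)))
      atTop (𝓝 (scaledLog m + c * (1 / 10 ^ m))) := by
    intro c
    have h := (((tendsto_one_div_ten_pow m).const_sub (1 / 10 ^ m)).const_mul c).const_add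
      (scaledLog m)
    rwa [sub_zero] at h
  exact ⟨le_of_tendsto_of_tendsto' (hs _) hm (le_scaledLog_add m),
    le_of_tendsto_of_tendsto' hm (hs _) (scaledLog_add_le m)⟩

theorem tendsto_log_alpha_div : Tendsto (fun n => Real.log (alpha n) / 10 ^ n) atTop (𝓝 0) := by
  have h1 : Tendsto (fun n : ℕ => ((1 : ℝ) / 10) ^ n) atTop (𝓝 0) :=
    tendsto_pow_atTop_nhds_zero_of_lt_one (by norm_num) (by norm_num)
  have h2 : Tendsto (fun n : ℕ => (n : ℝ) * ((1 : ℝ) / 10) ^ n) atTop (𝓝 0) :=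
    tendsto_self_mul_const_pow_of_lt_one (by norm_num) (by norm_num)
  have h3 := (h1.const_mul (Real.log 4)).add (h2.const_mul (increment 0))
  simp only [mul_zero, add_zero] at h3
  refine squeeze_zero_norm (fun n => ?_) h3
  rw [Real.norm_eq_abs, abs_div, abs_of_pos (by positivity : (0 : ℝ) < 10 ^ n),
    div_le_iff₀ (by positivity)]
  refine (abs_log_alpha_le n).trans (le_of_eq ?_)
  rw [div_pow, one_pow]
  field_simp

/-- Uses 3 ln f = (ln f + 2 ln g) + 2 ln α and 3 v_n = 4·10ⁿ + 5; after division by 10ⁿ the α term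
vanishes in the limit. -/
theorem tendsto_log_div_card {T : ℝ} (hT : Tendsto scaledLog atTop (𝓝 T)) :
    Tendsto (fun n : ℕ => Real.log (numCSSG (gasket 4 n) : ℝ) / (Nat.card (gasketVerts 4 n) : ℝ))
      atTop (𝓝 (T / 4)) := by
  have h1 : Tendsto (fun n : ℕ => (4 : ℝ) + 5 * (1 / 10 ^ (0 + n))) atTop (𝓝 (4 + 5 * 0)) :=
    ((tendsto_one_div_ten_pow 0).const_mul 5).const_add 4
  have h2 := (hT.add (tendsto_log_alpha_div.const_mul 2)).div h1 (by norm_num)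
  have e : (T + 2 * 0) / (4 + 5 * 0) = T / 4 := by norm_num
  rw [e] at h2
  refine h2.congr fun n => ?_
  have hc : (Nat.card (gasketVerts 4 n) : ℝ) = (4 * 10 ^ n + 5) / 3 := by
    rw [eq_div_iff (by norm_num), mul_comm]
    exact_mod_cast card_gasketVerts n
  change (logSum n / 10 ^ n + 2 * (Real.log (alpha n) / 10 ^ n)) / (4 + 5 * (1 / 10 ^ (0 + n))) =
    Real.log (gasketF 4 n : ℝ) / _
  rw [hc, zero_add, log_alpha]
  unfold logSum
  field_simp
  ring

/-! ### Numerical bounds -/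

/-- Writes W as about 2ᵉ(1 + x)/(1 - x) and uses ten terms of ln((1 + x)/(1 - x)) = 2(x + x³/3 +
x⁵/5 + ...). -/
theorem le_log_of_le {W x b : ℝ} {e : ℕ} (hx : 0 ≤ x) (hx1 : x < 1)
    (hW : 2 ^ e * (1 + x) ≤ W * (1 - x))
    (hb : b ≤ e * 0.6931471803 + 2 * ∑ i ∈ Finset.range 10, x ^ (2 * i + 1) / (2 * i + 1)) :
    b ≤ Real.log W := by
  have h1 := Real.sum_range_le_log_div hx hx1 10
  have h2 : Real.log (2 ^ e * ((1 + x) / (1 - x))) ≤ Real.log W := by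
    have : 0 < 1 - x := by linarith
    refine Real.log_le_log (by positivity) ?_
    rwa [← mul_div_assoc, div_le_iff₀ this]
  have : 0 < 1 - x := by linarith
  rw [Real.log_mul (by positivity) (by positivity), Real.log_pow] at h2
  have h3 : (e : ℝ) * 0.6931471803 ≤ e * Real.log 2 := by
    gcongr
    exact Real.log_two_gt_d9.le
  linarith

theorem log_le_of_le {W x b : ℝ} {e : ℕ} (hx : 0 ≤ x) (hx1 : x < 1) (hW0 : 0 < W)
    (hW : W * (1 - x) ≤ 2 ^ e * (1 + x))
    (hb : e * 0.6931471808 + 2 * ((∑ i ∈ Finset.range 10, x ^ (2 * i + 1) / (2 * i + 1)) +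
      x ^ 21 / (1 - x ^ 2)) ≤ b) :
    Real.log W ≤ b := by
  have h1 := Real.log_div_le_sum_range_add hx hx1 10
  have : 0 < 1 - x := by linarith
  have h2 : Real.log W ≤ Real.log (2 ^ e * ((1 + x) / (1 - x))) := by
    refine Real.log_le_log hW0 ?_
    rwa [← mul_div_assoc, le_div_iff₀ this]
  rw [Real.log_mul (by positivity) (by positivity), Real.log_pow] at h2
  have h3 : (e : ℝ) * Real.log 2 ≤ e * 0.6931471808 := by
    gcongr
    exact Real.log_two_lt_d9.le
  norm_num at h1 hb
  linarith

theorem increment_eq (n : ℕ) : increment n = Real.log (stageP n * stageQ n ^ 2) := by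
  have hP : stageP n ≠ 0 := ((le_stageP n).trans_lt' (by norm_num)).ne'
  have hQ : stageQ n ≠ 0 := ((le_stageQ n).trans_lt' (by norm_num)).ne'
  rw [Real.log_mul hP (pow_ne_zero 2 hQ), Real.log_pow, increment]
  norm_num

theorem increment_bounds {n : ℕ} {al ah rl rh x y b c : ℝ} {d e : ℕ} (h0 : 0 ≤ al) (h0' : 0 ≤ rl)
    (h : (al ≤ alpha n ∧ alpha n ≤ ah) ∧ rl ≤ rho n ∧ rho n ≤ rh)
    (hx : 0 ≤ x) (hx1 : x < 1) (hy : 0 ≤ y) (hy1 : y < 1)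
    (hl : 2 ^ d * (1 + x) ≤ recP al rl * recQ al rl ^ 2 * (1 - x))
    (hu : recP ah rh * recQ ah rh ^ 2 * (1 - y) ≤ 2 ^ e * (1 + y))
    (hb : b ≤ d * 0.6931471803 + 2 * ∑ i ∈ Finset.range 10, x ^ (2 * i + 1) / (2 * i + 1))
    (hc : e * 0.6931471808 + 2 * ((∑ i ∈ Finset.range 10, y ^ (2 * i + 1) / (2 * i + 1)) +
      y ^ 21 / (1 - y ^ 2)) ≤ c) :
    b ≤ increment n ∧ increment n ≤ c := by
  obtain ⟨⟨h1, h2⟩, h3, h4⟩ := h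
  have ha := h0.trans h1
  have hr := h0'.trans h3
  have P0 := recP_pos h0 h0'
  have Q0 := recQ_pos h0 h0'
  have P1 : 0 < stageP n := recP_pos ha hr
  have Q1 : 0 < stageQ n := recQ_pos ha hr
  have p1 : recP al rl ≤ stageP n := recP_mono h0 h1 h0' h3
  have p2 : stageP n ≤ recP ah rh := recP_mono ha h2 hr h4
  have q1 : recQ al rl ≤ stageQ n := recQ_mono h0 h1 h0' h3
  have q2 : stageQ n ≤ recQ ah rh := recQ_mono ha h2 hr h4
  have P2 := P1.trans_le p2
  rw [increment_eq]
  constructor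
  · refine (le_log_of_le hx hx1 hl hb).trans ?_
    gcongr
  · refine le_trans ?_ (log_le_of_le hy hy1 (mul_pos (P1.trans_le p2) (pow_pos (Q1.trans_le q2) 2))
      hu hc)
    gcongr

theorem bounds_zero : ((4 : ℝ) ≤ alpha 0 ∧ alpha 0 ≤ 4) ∧ (4 : ℝ) ≤ rho 0 ∧ rho 0 ≤ 4 := by
  simp [alpha_zero, rho_zero]

theorem increment_zero : 41.387882262 ≤ increment 0 ∧ increment 0 ≤ 41.387882292 := by
  -- With W = PQ² and 2ᵉ the power of two just below W, `x` and `y` bracket (W - 2ᵉ)/(W + 2ᵉ). The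
  -- later stages are treated alike.
  refine increment_bounds (x := 0.24124847025) (y := 0.24124847026) (d := 59) (e := 59)
    (by norm_num) (by norm_num) bounds_zero (by norm_num) (by norm_num) (by norm_num)
    (by norm_num) ?_ ?_ ?_ ?_ <;>
  norm_num [recP, recQ, Finset.sum_range_succ]

theorem increment_one : 37.535274618 ≤ increment 1 ∧ increment 1 ≤ 37.535274646 := by
  refine increment_bounds (x := 0.05261480861) (y := 0.05261480862) (d := 54) (e := 54)
    (by norm_num) (by norm_num) bounds_one (by norm_num) (by norm_num) (by norm_num)
    (by norm_num) ?_ ?_ ?_ ?_ <;>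
  norm_num [recP, recQ, Finset.sum_range_succ]

theorem increment_two : 35.419011992 ≤ increment 2 ∧ increment 2 ≤ 35.419012018 := by
  refine increment_bounds (x := 0.03423950877) (y := 0.03423950878) (d := 51) (e := 51)
    (by norm_num) (by norm_num) bounds_two (by norm_num) (by norm_num) (by norm_num)
    (by norm_num) ?_ ?_ ?_ ?_ <;>
  norm_num [recP, recQ, Finset.sum_range_succ]

theorem increment_three : 34.180193626 ≤ increment 3 ∧ increment 3 ≤ 34.180193651 := by
  refine increment_bounds (x := 0.10757304703) (y := 0.10757304704) (d := 49) (e := 49)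
    (by norm_num) (by norm_num) bounds_three (by norm_num) (by norm_num) (by norm_num)
    (by norm_num) ?_ ?_ ?_ ?_ <;>
  norm_num [recP, recQ, Finset.sum_range_succ]

theorem increment_four : 33.568880727 ≤ increment 4 ∧ increment 4 ≤ 33.568880752 := by
  refine increment_bounds (x := 0.14781710209) (y := 0.1478171021) (d := 48) (e := 48)
    (by norm_num) (by norm_num) bounds_four (by norm_num) (by norm_num) (by norm_num)
    (by norm_num) ?_ ?_ ?_ ?_ <;>
  norm_num [recP, recQ, Finset.sum_range_succ]

theorem increment_five : 33.299164613 ≤ increment 5 ∧ increment 5 ≤ 33.299164638 := by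
  refine increment_bounds (x := 0.01404905519) (y := 0.01404905521) (d := 48) (e := 48)
    (by norm_num) (by norm_num) bounds_five (by norm_num) (by norm_num) (by norm_num)
    (by norm_num) ?_ ?_ ?_ ?_ <;>
  norm_num [recP, recQ, Finset.sum_range_succ]

theorem le_limit_increment : 33.110943051 ≤ Real.log 33620 + 2 * Real.log 84460 := by
  have h : Real.log 33620 + 2 * Real.log 84460 = Real.log (33620 * 84460 ^ 2) := by
    rw [Real.log_mul (by norm_num) (by norm_num), Real.log_pow]
    norm_num
  rw [h]
  refine le_log_of_le (x := 0.26037700605) (e := 47) (by norm_num) (by norm_num) ?_ ?_ <;>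
  norm_num [Finset.sum_range_succ]

theorem scaledLog_five : scaledLog 5 = 2 * Real.log 2 + increment 0 / 10 + increment 1 / 10 ^ 2 +
    increment 2 / 10 ^ 3 + increment 3 / 10 ^ 4 + increment 4 / 10 ^ 5 := by
  have h4 : Real.log 4 = 2 * Real.log 2 := by
    rw [show (4 : ℝ) = 2 ^ 2 by norm_num, Real.log_pow]
    norm_num
  have h0 : scaledLog 0 = 2 * Real.log 2 := by simp [scaledLog, logSum_zero, h4]
  rw [scaledLog_succ, scaledLog_succ, scaledLog_succ, scaledLog_succ, scaledLog_succ, h0]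
  norm_num

/-! ### The growth constant -/

theorem proposition3 :
    ∃ z : ℝ,
      Tendsto
        (fun n : ℕ => Real.log (numCSSG (gasket 4 n) : ℝ) / (Nat.card (gasketVerts 4 n) : ℝ))
        atTop (𝓝 z) ∧
      (∀ m : ℕ, 0 < m →
        1 / (4 * 10 ^ m) * (Real.log (gasketF 4 m : ℝ) + 2 * Real.log (gasketG 4 m : ℝ))
            + 1 / (36 * 10 ^ m) * (Real.log 33620 + 2 * Real.log 84460) ≤ z ∧
        z ≤ 1 / (4 * 10 ^ m) * (Real.log (gasketF 4 m : ℝ) + 2 * Real.log (gasketG 4 m : ℝ))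
            + 1 / (36 * 10 ^ m) * (Real.log (polyP (gasketAlpha 4 m) (gasketBeta 4 m))
              + 2 * Real.log (polyQ (gasketAlpha 4 m) (gasketBeta 4 m)))) ∧
      1.4849112 ≤ z ∧ z < 1.4849113 := by
  obtain ⟨T, hT, hb⟩ := exists_tendsto_scaledLog
  refine ⟨T / 4, tendsto_log_div_card hT, fun m _ => ?_, ?_, ?_⟩
  · obtain ⟨h1, h2⟩ := hb m
    rw [polyP_eq, polyQ_eq]
    change 1 / (4 * 10 ^ m) * logSum m + 1 / (36 * 10 ^ m) * (Real.log 33620 + 2 * Real.log 84460) ≤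
      T / 4 ∧ T / 4 ≤ 1 / (4 * 10 ^ m) * logSum m + 1 / (36 * 10 ^ m) * increment m
    have e : ∀ c : ℝ, 1 / (4 * 10 ^ m) * logSum m + 1 / (36 * 10 ^ m) * c =
        (scaledLog m + c / 9 * (1 / 10 ^ m)) / 4 := by
      intro c
      unfold scaledLog
      field_simp
      ring
    rw [e, e]
    exact ⟨by linarith, by linarith⟩
  -- At m = 5 the two bounds differ by about (33.2992 - 33.1109)/(36·10⁵), roughly 5·10⁻⁸, below the
  -- required 10⁻⁷; at m = 4 the gap exceeds 10⁻⁶.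
  · have h := (hb 5).1
    rw [scaledLog_five] at h
    linarith [increment_zero.1, increment_one.1, increment_two.1, increment_three.1,
      increment_four.1, le_limit_increment, Real.log_two_gt_d9]
  · have h := (hb 5).2
    rw [scaledLog_five] at h
    linarith [increment_zero.2, increment_one.2, increment_two.2, increment_three.2,
      increment_four.2, increment_five.2, Real.log_two_lt_d9]
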